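/- Fix a set $\mathcal P$ of predicate symbols, each with an arity $n\ge 0$, and an infinite set $\mathbf X$ of variables. A \emph{(constant-domain first-order Kripke) model} is $\mathcal M=(W,D,R,\rho)$ with $W,D\neq\emptyset$, $R\subseteq W^2$, and $\rho(P,w)\subseteq D^n$ for each $n$-ary $P\in\mathcal P$ and $w\in W$. It is an \emph{$S4.2$-model} if $R$ is reflexive, transitive and strongly convergent: for every $w$ there is $u$ such that $wRv$ implies $vRu$ for all $v$. Let $[\mathsf K_{\mathtt{wh}}]$ be one of four operator symbols $[\mathsf{tB}^{\mathtt{MS}}]$, $[\mathsf{tB}^{\mathtt{MS}}_{\mathtt{FS}}]$, $[\mathsf K^{\mathtt{MS}}]$, $[\mathsf K^{\mathtt{MS}}_{\mathtt{FS}}]$. The formulas of $\mathcal L([\mathsf K_{\mathtt{wh}}])$ are $$\phi ::= P(y_1,\dots,y_n)\mid \neg\phi\mid\phi\wedge\phi\mid[\mathsf K]\phi\mid[\mathsf K_{\mathtt{wh}}]^x\phi ,$$ where $[\mathsf K_{\mathtt{wh}}]^x$ binds $x$; $\mathcal L_\approx([\mathsf K_{\mathtt{wh}}])$ has in addition the atoms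 $x\approx y$. Put $\langle\mathsf K\rangle\phi:=\neg[\mathsf K]\neg\phi$ and $[\mathsf B]\phi:=\langle\mathsf K\rangle[\mathsf K]\phi$. Satisfaction $\mathcal M,w,\sigma\vDash\phi$ (with $\sigma:\mathbf X\to D$) is defined as usual for atoms, $\approx$ (equality on $D$), $\neg$, $\wedge$, and $[\mathsf K]$ (truth at all $R$-successors), while, writing $\phi(a)$ for the evaluation of $\phi$ under $\sigma[x\mapsto a]$, at $w$: \begin{itemize} \item $[\mathsf{tB}^{\mathtt{MS}}]^x\phi$ holds iff $[\mathsf B]\phi(a)\wedge\phi(a)$ for some $a\in D$; \item $[\mathsf{tB}^{\mathtt{MS}}_{\mathtt{FS}}]^x\phi$ holds iff $[\mathsf B]\phi(a)\wedge\phi(a)$ for some $a\in D$, and $[\mathsf B]\phi(b)\to\phi(b)$ for all $b\in D$; \item $[\mathsf K^{\mathtt{MS}}]^x\phi$ holds iff $[\mathsf K]\phi(a)$ for some $a\in D$; \item $[\mathsf K^{\mathtt{MS}}_{\mathtt{FS}}]^x\phi$ holds iff $[\mathsf K]\phi(a)$ for some $a\in D$, and $[\mathsf B]\phi(b)\to\phi(b)$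 for all $b\in D$. \end{itemize} Let $\mathbf{S4.2}^{[\mathsf K]}$ consist of all instances of propositional tautologies, the axioms $[\mathsf K](\phi\to\psi)\to([\mathsf K]\phi\to[\mathsf K]\psi)$, $[\mathsf K]\phi\to\phi$, $[\mathsf K]\phi\to[\mathsf K][\mathsf K]\phi$, $\langle\mathsf K\rangle[\mathsf K]\phi\to[\mathsf K]\langle\mathsf K\rangle\phi$, modus ponens, and necessitation for $[\mathsf K]$. Write $\phi[y/x]$ for the replacement of all free occurrences of $x$ in $\phi$ by $y$; whenever it is used, no free occurrence of $x$ in $\phi$ may lie in the scope of $[\mathsf K_{\mathtt{wh}}]^y$. Consider the axioms \begin{itemize} \item (TBtoKwh) $([\mathsf B]\phi\wedge\phi)[y/x]\to[\mathsf K_{\mathtt{wh}}]^x\phi$; \item (KtoKwh) $[\mathsf K]\phi[y/x]\to[\mathsf K_{\mathtt{wh}}]^x\phi$; \item (KwhtoFS) $[\mathsf K_{\mathtt{wh}}]^x\phi\to([\mathsf B]\phi\to\phi)[y/x]$; \item (BtoBKwh) $[\mathsf B]\phi[y/x]\to[\mathsf B][\mathsf K_{\mathtt{wh}}]^x\phi$,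 \end{itemize} and, writing $C(\chi)$ for $\psi_0\to[\mathsf K](\psi_1\to\cdots[\mathsf K](\psi_n\to\chi)\cdots)$ with $n\ge0$ and $x$ not free in any $\psi_i$, the rules \begin{itemize} \item (KwhtoTB) from $\vdash C(\neg([\mathsf B]\phi\wedge\phi))$ infer $\vdash C(\neg[\mathsf K_{\mathtt{wh}}]^x\phi)$; \item (KwhtoK) from $\vdash C(\neg[\mathsf K]\phi)$ infer $\vdash C(\neg[\mathsf K_{\mathtt{wh}}]^x\phi)$; \item (FS\&BtoKwh) from $\vdash C([\mathsf B]\phi\to\phi)$ infer $\vdash C([\mathsf B]\phi[y/x]\to[\mathsf K_{\mathtt{wh}}]^x\phi)$; \item (FS\&KtoKwh) from $\vdash C([\mathsf B]\phi\to\phi)$ infer $\vdash C([\mathsf K]\phi[y/x]\to[\mathsf K_{\mathtt{wh}}]^x\phi)$. \end{itemize} The logic $\mathbf{S4.2}^{[\mathsf K_{\mathtt{wh}}]}$ extends $\mathbf{S4.2}^{[\mathsf K]}$ (in the language $\mathcal L([\mathsf K_{\mathtt{wh}}])$) by: TBtoKwh and KwhtoTB, for $[\mathsf{tB}^{\mathtt{MS}}]$;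 KwhtoFS, BtoBKwh, KwhtoTB and FS\&BtoKwh, for $[\mathsf{tB}^{\mathtt{MS}}_{\mathtt{FS}}]$; KtoKwh and KwhtoK, for $[\mathsf K^{\mathtt{MS}}]$; KwhtoFS, BtoBKwh, KwhtoK and FS\&KtoKwh, for $[\mathsf K^{\mathtt{MS}}_{\mathtt{FS}}]$. The logic $\mathbf{S4.2}_\approx^{[\mathsf K_{\mathtt{wh}}]}$, in the language $\mathcal L_\approx([\mathsf K_{\mathtt{wh}}])$, has in addition the axioms $x\approx x$, $x\approx y\to(\phi[x/z]\to\phi[y/z])$ and $x\not\approx y\to[\mathsf K](x\not\approx y)$. For a set $\Gamma$ of formulas, $\Gamma\vdash\phi$ means that $\gamma_1\to(\cdots(\gamma_m\to\phi)\cdots)$ is a theorem of the logic for some $m\ge0$ and $\gamma_1,\dots,\gamma_m\in\Gamma$; and $\Gamma\vDash\phi$ means that $\mathcal M,w,\sigma\vDash\phi$ whenever $\mathcal M$ is an $S4.2$-model, $w$ a world, $\sigma$ an assignment, and $\mathcal M,w,\sigma\vDash\gamma$ for all $\gamma\in\Gamma$. \textbf{Theorem.} For each of the four operators $[\mathsf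 K_{\mathtt{wh}}]$, the logic $\mathbf{S4.2}^{[\mathsf K_{\mathtt{wh}}]}$ is sound and strongly complete with respect to the class of constant-domain $S4.2$-models: for all sets $\Gamma$ of $\mathcal L([\mathsf K_{\mathtt{wh}}])$-formulas and all $\mathcal L([\mathsf K_{\mathtt{wh}}])$-formulas $\phi$, $\Gamma\vdash\phi$ if and only if $\Gamma\vDash\phi$. The same holds for $\mathbf{S4.2}_\approx^{[\mathsf K_{\mathtt{wh}}]}$ and $\mathcal L_\approx([\mathsf K_{\mathtt{wh}}])$. -/

import Mathlib

universe u v w₁ w₂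

namespace KnowWh

/-- The four bundled operators `[tB^MS]`, `[tB^MS_FS]`, `[K^MS]`, `[K^MS_FS]`. -/
inductive WhOp : Type
  | tB
  | tBFS
  | K
  | KFS

/-- Formulas over a set `P` of predicate symbols with arities `ar` and a set `X` of variables.
`Formula ar X op false` is the language with `[K]` and the bundled operator `op`;
`Formula ar X op true` is the same language with identity. -/
inductive Formula {P : Type u} (ar : P → ℕ) (X : Type v) (op : WhOp) (ident : Bool) :
    Type (max u v)
  | atom (p : P) (t : Fin (ar p) → X) : Formula ar X op ident
  | eq (h : ident = true) (x y : X) : Formula ar X op ident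
  | neg (φ : Formula ar X op ident) : Formula ar X op ident
  | conj (φ ψ : Formula ar X op ident) : Formula ar X op ident
  | know (φ : Formula ar X op ident) : Formula ar X op ident
  | wh (x : X) (φ : Formula ar X op ident) : Formula ar X op ident

namespace Formula

variable {P : Type u} {ar : P → ℕ} {X : Type v} {op : WhOp} {ident : Bool}

/-- Material implication. -/
def imp (φ ψ : Formula ar X op ident) : Formula ar X op ident := neg (conj φ (neg ψ))

/-- `⟨K⟩ φ := ¬ [K] ¬ φ`. -/
def poss (φ : Formula ar X op ident) : Formula ar X op ident := neg (know (neg φ))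

/-- `[B] φ := ⟨K⟩ [K] φ`. -/
def bel (φ : Formula ar X op ident) : Formula ar X op ident := poss (know φ)

/-- Free variables; `wh x` binds `x`. -/
def FV : Formula ar X op ident → Set X
  | atom _ t => Set.range t
  | eq _ x y => {x, y}
  | neg φ => FV φ
  | conj φ ψ => FV φ ∪ FV ψ
  | know φ => FV φ
  | wh x φ => FV φ \ {x}

/-- `φ.subst x y` is `φ[y/x]`: every free occurrence of `x` is replaced by `y`. -/
def subst [DecidableEq X] (x y : X) : Formula ar X op ident → Formula ar X op ident
  | atom p t => atom p (fun i => if t i = x then y else t i)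
  | eq h a b => eq h (if a = x then y else a) (if b = x then y else b)
  | neg φ => neg (subst x y φ)
  | conj φ ψ => conj (subst x y φ) (subst x y ψ)
  | know φ => know (subst x y φ)
  | wh z φ => if z = x then wh z φ else wh z (subst x y φ)

/-- `φ.Admissible x y`: `y` is admissible for `x` in `φ`, i.e. no free occurrence of `x` in `φ`
lies in the scope of an operator binding `y`. -/
def Admissible (x y : X) : Formula ar X op ident → Prop
  | atom _ _ => True
  | eq _ _ _ => True
  | neg φ => Admissible x y φ
  | conj φ ψ => Admissible x y φ ∧ Admissible x y ψ
  | know φ => Admissible x y φ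
  | wh z φ => x ∉ FV (wh z φ) ∨ (z ≠ y ∧ Admissible x y φ)

/-- `chain ψ₀ [ψ₁, …, ψₙ] χ` is `ψ₀ → [K](ψ₁ → ⋯ [K](ψₙ → χ) ⋯)`. -/
def chain : Formula ar X op ident → List (Formula ar X op ident) → Formula ar X op ident →
    Formula ar X op ident
  | ψ, [], χ => imp ψ χ
  | ψ, ψ' :: l, χ => imp ψ (know (chain ψ' l χ))

/-- Instances of propositional tautologies: true under every valuation that respects the Boolean
connectives (all other formulas being treated as atoms). -/
def IsTautology (φ : Formula ar X op ident) : Prop :=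
  ∀ val : Formula ar X op ident → Prop,
    (∀ ψ, val (neg ψ) ↔ ¬ val ψ) → (∀ ψ χ, val (conj ψ χ) ↔ val ψ ∧ val χ) → val φ

end Formula

open Formula

/-- `Provable φ`: `φ` is a theorem of `S4.2^{op}` (for `ident = false`), respectively of
`S4.2_≈^{op}` (for `ident = true`). -/
inductive Provable {P : Type u} {ar : P → ℕ} {X : Type v} [DecidableEq X] {op : WhOp}
    {ident : Bool} : Formula ar X op ident → Prop
  -- the system S4.2 for `[K]`
  | taut (φ : Formula ar X op ident) : IsTautology φ → Provable φ
  | axK (φ ψ : Formula ar X op ident) :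
      Provable (imp (know (imp φ ψ)) (imp (know φ) (know ψ)))
  | axT (φ : Formula ar X op ident) : Provable (imp (know φ) φ)
  | ax4 (φ : Formula ar X op ident) : Provable (imp (know φ) (know (know φ)))
  | ax2 (φ : Formula ar X op ident) : Provable (imp (poss (know φ)) (know (poss φ)))
  | mp (φ ψ : Formula ar X op ident) : Provable (imp φ ψ) → Provable φ → Provable ψ
  | nec (φ : Formula ar X op ident) : Provable φ → Provable (know φ)
  -- axioms for the bundled operators
  | TBtoKwh (x y : X) (φ : Formula ar X op ident) :
      op = WhOp.tB → Admissible x y φ →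
      Provable (imp (subst x y (conj (bel φ) φ)) (wh x φ))
  | KtoKwh (x y : X) (φ : Formula ar X op ident) :
      op = WhOp.K → Admissible x y φ →
      Provable (imp (know (subst x y φ)) (wh x φ))
  | KwhtoFS (x y : X) (φ : Formula ar X op ident) :
      op = WhOp.tBFS ∨ op = WhOp.KFS → Admissible x y φ →
      Provable (imp (wh x φ) (subst x y (imp (bel φ) φ)))
  | BtoBKwh (x y : X) (φ : Formula ar X op ident) :
      op = WhOp.tBFS ∨ op = WhOp.KFS → Admissible x y φ →
      Provable (imp (bel (subst x y φ)) (bel (wh x φ)))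
  -- rules for the bundled operators
  | KwhtoTB (x : X) (φ ψ : Formula ar X op ident) (l : List (Formula ar X op ident)) :
      op = WhOp.tB ∨ op = WhOp.tBFS → (∀ χ ∈ ψ :: l, x ∉ FV χ) →
      Provable (chain ψ l (neg (conj (bel φ) φ))) →
      Provable (chain ψ l (neg (wh x φ)))
  | KwhtoK (x : X) (φ ψ : Formula ar X op ident) (l : List (Formula ar X op ident)) :
      op = WhOp.K ∨ op = WhOp.KFS → (∀ χ ∈ ψ :: l, x ∉ FV χ) →
      Provable (chain ψ l (neg (know φ))) →
      Provable (chain ψ l (neg (wh x φ)))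
  | FSBtoKwh (x y : X) (φ ψ : Formula ar X op ident) (l : List (Formula ar X op ident)) :
      op = WhOp.tBFS → Admissible x y φ → (∀ χ ∈ ψ :: l, x ∉ FV χ) →
      Provable (chain ψ l (imp (bel φ) φ)) →
      Provable (chain ψ l (imp (bel (subst x y φ)) (wh x φ)))
  | FSKtoKwh (x y : X) (φ ψ : Formula ar X op ident) (l : List (Formula ar X op ident)) :
      op = WhOp.KFS → Admissible x y φ → (∀ χ ∈ ψ :: l, x ∉ FV χ) →
      Provable (chain ψ l (imp (bel φ) φ)) →
      Provable (chain ψ l (imp (know (subst x y φ)) (wh x φ)))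
  -- identity axioms (only in the language with identity)
  | eqRefl (h : ident = true) (x : X) : Provable (eq h x x)
  | eqSubst (h : ident = true) (x y z : X) (φ : Formula ar X op ident) :
      Admissible z x φ → Admissible z y φ →
      Provable (imp (eq h x y) (imp (subst z x φ) (subst z y φ)))
  | neKnow (h : ident = true) (x y : X) :
      Provable (imp (neg (eq h x y)) (know (neg (eq h x y))))

/-- `Γ ⊢ φ`: there are `γ₁, …, γₘ ∈ Γ` such that `γ₁ → (γ₂ → ⋯ (γₘ → φ))` is a theorem. -/
def Derives {P : Type u} {ar : P → ℕ} {X : Type v} [DecidableEq X] {op : WhOp} {ident : Bool}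
    (Γ : Set (Formula ar X op ident)) (φ : Formula ar X op ident) : Prop :=
  ∃ l : List (Formula ar X op ident), (∀ γ ∈ l, γ ∈ Γ) ∧ Provable (l.foldr imp φ)

/-- First-order Kripke models with a constant domain. -/
structure KripkeModel {P : Type u} (ar : P → ℕ) : Type (max u (w₁ + 1) (w₂ + 1)) where
  W : Type w₁
  D : Type w₂
  nonempty_W : Nonempty W
  nonempty_D : Nonempty D
  R : W → W → Prop
  ρ : (p : P) → W → Set (Fin (ar p) → D)

namespace KripkeModel

variable {P : Type u} {ar : P → ℕ}

/-- For all `w` there is `u` such that every successor of `w` sees `u`. -/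
def StronglyConvergent (M : KripkeModel.{u, w₁, w₂} ar) : Prop :=
  ∀ w : M.W, ∃ u : M.W, ∀ v : M.W, M.R w v → M.R v u

/-- `S4.2`-models. -/
structure IsS42 (M : KripkeModel.{u, w₁, w₂} ar) : Prop where
  refl : ∀ w : M.W, M.R w w
  trans : ∀ w v u : M.W, M.R w v → M.R v u → M.R w u
  conv : M.StronglyConvergent

/-- Semantics of `[K]` on sets of worlds. -/
def Knows (M : KripkeModel.{u, w₁, w₂} ar) (p : M.W → Prop) (w : M.W) : Prop :=
  ∀ v : M.W, M.R w v → p v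

/-- Semantics of `[B] = ¬ [K] ¬ [K]` on sets of worlds. -/
def Believes (M : KripkeModel.{u, w₁, w₂} ar) (p : M.W → Prop) (w : M.W) : Prop :=
  ¬ M.Knows (fun v => ¬ M.Knows p v) w

/-- Semantics of the four bundled operators, applied to a property `p a v` of objects `a` at
worlds `v`. -/
def KnowsWh (M : KripkeModel.{u, w₁, w₂} ar) :
    WhOp → (M.D → M.W → Prop) → M.W → Prop
  | WhOp.tB, p, w => ∃ a : M.D, M.Believes (p a) w ∧ p a w
  | WhOp.tBFS, p, w =>
      (∃ a : M.D, M.Believes (p a) w ∧ p a w) ∧ ∀ b : M.D, M.Believes (p b) w → p b w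
  | WhOp.K, p, w => ∃ a : M.D, M.Knows (p a) w
  | WhOp.KFS, p, w =>
      (∃ a : M.D, M.Knows (p a) w) ∧ ∀ b : M.D, M.Believes (p b) w → p b w

variable {X : Type v} [DecidableEq X] {op : WhOp} {ident : Bool}

/-- `M.Sat φ w σ` is `M, w, σ ⊨ φ`. -/
def Sat (M : KripkeModel.{u, w₁, w₂} ar) :
    Formula ar X op ident → M.W → (X → M.D) → Prop
  | atom p t, w, σ => (fun i => σ (t i)) ∈ M.ρ p w
  | eq _ x y, _, σ => σ x = σ y
  | neg φ, w, σ => ¬ M.Sat φ w σ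
  | conj φ ψ, w, σ => M.Sat φ w σ ∧ M.Sat ψ w σ
  | know φ, w, σ => M.Knows (fun v => M.Sat φ v σ) w
  | wh x φ, w, σ => M.KnowsWh op (fun a v => M.Sat φ v (Function.update σ x a)) w

/-- The clause used for belief in `KnowsWh` is the satisfaction of the formula `[B] φ`. -/
theorem sat_bel (M : KripkeModel.{u, w₁, w₂} ar) (φ : Formula ar X op ident) (w : M.W)
    (σ : X → M.D) : M.Sat (bel φ) w σ ↔ M.Believes (fun v => M.Sat φ v σ) w :=
  Iff.rfl

end KripkeModel

/-- `Γ ⊨ φ` (local consequence) over the class of `S4.2` constant-domain models. -/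
def Entails {P : Type u} {ar : P → ℕ} {X : Type v} [DecidableEq X] {op : WhOp} {ident : Bool}
    (Γ : Set (Formula ar X op ident)) (φ : Formula ar X op ident) : Prop :=
  ∀ M : KripkeModel.{u, w₁, w₂} ar, M.IsS42 → ∀ (w : M.W) (σ : X → M.D),
    (∀ γ ∈ Γ, M.Sat γ w σ) → M.Sat φ w σ

end KnowWh

/-! Soundness is an induction on derivations. The only point where the frame matters is strong
convergence: every world has a final successor at which all beliefs are known
(`IsS42.exists_final`). From there on belief implies truth, so false-sensitivity is automatic and
BtoBKwh holds; the same world validates axiom .2. The rules are sound because the domain is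
constant: a value for `x` can be carried through a chain of boxes in whose premises `x` is not free.

Completeness is a Henkin construction whose objects are variables. Two obstacles are removed first.
A set of formulas may leave no variable fresh, so strong completeness is reduced to single formulas
by an ultraproduct argument (`derives_of_entails_of_weak`). The enumeration of requirements needs
countably many formulas, so a single formula is moved into a countable sublanguage
(`exists_countermodel_of_countable`).

Fix the finite set `B` of bound variables of the formula, renamed apart from its free ones. The
domain consists of the variables outside `B`, so that substitution never captures. The heart is
`IsHenkin`: a failing chain of boxes that ends in a quantified claim already fails for some
instance. Witnesses are demanded below chains of boxes and not merely at the current world, because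
then the property passes from `w` to the theory of what `w` knows (`isHenkin_know`), and successors
can be built without adding objects. The rules of the logic say exactly that the set of theorems has
this property (`isHenkin_provable`), and `IsTheory.exists_isHenkin` extends a theory to a maximal
consistent set while preserving it.

For strong convergence, any maximal consistent set containing everything believed at `w` is
accessible from all successors of `w`. It inherits the Henkin property with no further construction,
since whatever is possible after `w` and entails a belief is already known there
(`IsHenkin.exists_final`). The truth lemma `canonicalModel_sat` then yields the countermodel. -/

namespace KnowWh

/-! ### Syntax: variables, substitution, and countability of the language. -/

namespace Formula

variable {P : Type u} {ar : P → ℕ} {X : Type v} {op : WhOp} {ident : Bool}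

/-- Bound variables. -/
def BV : Formula ar X op ident → Set X
  | atom _ _ => ∅
  | eq _ _ _ => ∅
  | neg φ => BV φ
  | conj φ ψ => BV φ ∪ BV ψ
  | know φ => BV φ
  | wh x φ => insert x (BV φ)

theorem finite_FV : ∀ φ : Formula ar X op ident, φ.FV.Finite
  | atom _ t => Set.finite_range t
  | eq _ x y => by simp [FV]
  | neg φ => finite_FV φ
  | conj φ ψ => (finite_FV φ).union (finite_FV ψ)
  | know φ => finite_FV φ
  | wh _ φ => (finite_FV φ).sdiff

theorem finite_BV : ∀ φ : Formula ar X op ident, φ.BV.Finite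
  | atom _ _ => Set.finite_empty
  | eq _ _ _ => Set.finite_empty
  | neg φ => finite_BV φ
  | conj φ ψ => (finite_BV φ).union (finite_BV ψ)
  | know φ => finite_BV φ
  | wh x φ => (finite_BV φ).insert x

theorem admissible_of_notMem_BV {x y : X} :
    ∀ {φ : Formula ar X op ident}, y ∉ φ.BV → Admissible x y φ
  | atom _ _, _ => trivial
  | eq _ _ _, _ => trivial
  | neg φ, h => admissible_of_notMem_BV (φ := φ) h
  | conj φ ψ, h =>
    ⟨admissible_of_notMem_BV (φ := φ) fun h' => h (Or.inl h'),
      admissible_of_notMem_BV (φ := ψ) fun h' => h (Or.inr h')⟩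
  | know φ, h => admissible_of_notMem_BV (φ := φ) h
  | wh z φ, h => by
    simp only [BV, Set.mem_insert_iff, not_or] at h
    exact Or.inr ⟨Ne.symm h.1, admissible_of_notMem_BV h.2⟩

theorem admissible_self (x : X) : ∀ φ : Formula ar X op ident, Admissible x x φ
  | atom _ _ => trivial
  | eq _ _ _ => trivial
  | neg φ => admissible_self x φ
  | conj φ ψ => ⟨admissible_self x φ, admissible_self x ψ⟩
  | know φ => admissible_self x φ
  | wh z φ => by
    by_cases h : z = x
    · exact Or.inl fun h' => h'.2 h.symm
    · exact Or.inr ⟨h, admissible_self x φ⟩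

variable [DecidableEq X]

theorem subst_self (x : X) (φ : Formula ar X op ident) : φ.subst x x = φ := by
  induction φ with
  | atom p t => simp only [subst]; congr 1; ext i; split_ifs with h <;> simp [h]
  | eq h a b => simp only [subst]; congr 1 <;> split_ifs with h <;> simp [h]
  | neg φ ih => simp [subst, ih]
  | conj φ ψ ih₁ ih₂ => simp [subst, ih₁, ih₂]
  | know φ ih => simp [subst, ih]
  | wh z φ ih => simp [subst, ih]

theorem subst_of_notMem_FV {x y : X} {φ : Formula ar X op ident} (hx : x ∉ φ.FV) :
    φ.subst x y = φ := by
  induction φ with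
  | atom p t =>
    simp only [subst]; congr 1; ext i
    rw [if_neg fun h => hx ⟨i, h⟩]
  | eq h a b =>
    simp only [FV, Set.mem_insert_iff, Set.mem_singleton_iff, not_or] at hx
    simp only [subst]; rw [if_neg (Ne.symm hx.1), if_neg (Ne.symm hx.2)]
  | neg φ ih => simp [subst, ih hx]
  | conj φ ψ ih₁ ih₂ =>
    simp [subst, ih₁ fun h => hx (Or.inl h), ih₂ fun h => hx (Or.inr h)]
  | know φ ih => simp [subst, ih hx]
  | wh z φ ih =>
    simp only [subst]
    split_ifs with h
    · rfl
    · rw [ih fun h' => hx ⟨h', fun e => h (Eq.symm e)⟩]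

theorem subst_subst_of_fresh {x z y : X} {φ : Formula ar X op ident} (hF : z ∉ φ.FV)
    (hB : z ∉ φ.BV) : (φ.subst x z).subst z y = φ.subst x y := by
  induction φ with
  | atom p t =>
    simp only [subst]; congr 1; ext i
    have : t i ≠ z := fun h => hF ⟨i, h⟩
    by_cases h : t i = x <;> simp [h]
    simp [this]
  | eq h a b =>
    simp only [FV, Set.mem_insert_iff, Set.mem_singleton_iff, not_or] at hF
    simp only [subst]
    congr 1
    · by_cases h : a = x <;> simp [h]; simp [Ne.symm hF.1]
    · by_cases h : b = x <;> simp [h]; simp [Ne.symm hF.2]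
  | neg φ ih => simp [subst, ih hF hB]
  | conj φ ψ ih₁ ih₂ =>
    simp [subst, ih₁ (fun h => hF (Or.inl h)) fun h => hB (Or.inl h),
      ih₂ (fun h => hF (Or.inr h)) fun h => hB (Or.inr h)]
  | know φ ih => simp [subst, ih hF hB]
  | wh w φ ih =>
    simp only [BV, Set.mem_insert_iff, not_or] at hB
    have hF' : z ∉ φ.FV := fun h => hF ⟨h, hB.1⟩
    by_cases h : w = x
    · simp [subst, h, subst_of_notMem_FV hF']
    · simp [subst, h, Ne.symm hB.1, ih hF' hB.2]

theorem BV_subst (x y : X) (φ : Formula ar X op ident) : (φ.subst x y).BV = φ.BV := by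
  induction φ with
  | atom p t => rfl
  | eq h a b => rfl
  | neg φ ih => exact ih
  | conj φ ψ ih₁ ih₂ => simp [subst, BV, ih₁, ih₂]
  | know φ ih => exact ih
  | wh z φ ih => simp only [subst]; split_ifs <;> simp [BV, ih]

theorem FV_subst_subset (x y : X) (φ : Formula ar X op ident) :
    (φ.subst x y).FV ⊆ insert y (φ.FV \ {x}) := by
  induction φ with
  | atom p t =>
    rintro _ ⟨i, rfl⟩
    by_cases h : t i = x
    · simp [h]
    · simp [h, FV]
  | eq h a b =>
    intro u hu
    simp only [subst, FV, Set.mem_insert_iff, Set.mem_singleton_iff, Set.mem_sdiff] at hu ⊢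
    rcases hu with rfl | rfl <;> split_ifs <;> simp [*]
  | neg φ ih => exact ih
  | conj φ ψ ih₁ ih₂ =>
    rintro u (hu | hu)
    · have := ih₁ hu; simp [FV] at this ⊢; tauto
    · have := ih₂ hu; simp [FV] at this ⊢; tauto
  | know φ ih => exact ih
  | wh z φ ih =>
    simp only [subst]
    split_ifs with h
    · intro u hu; subst h; simp [FV] at hu ⊢; tauto
    · intro u hu
      simp only [FV, Set.mem_insert_iff, Set.mem_singleton_iff, Set.mem_sdiff] at hu ⊢
      have := ih hu.1; simp at this; tauto

/-- Parallel substitution of variables for the free variables of a formula. -/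
def msubst : (X → X) → Formula ar X op ident → Formula ar X op ident
  | σ, atom p t => atom p fun i => σ (t i)
  | σ, eq h x y => eq h (σ x) (σ y)
  | σ, neg φ => neg (msubst σ φ)
  | σ, conj φ ψ => conj (msubst σ φ) (msubst σ ψ)
  | σ, know φ => know (msubst σ φ)
  | σ, wh x φ => wh x (msubst (Function.update σ x x) φ)

theorem msubst_congr {σ τ : X → X} {φ : Formula ar X op ident} (h : ∀ x ∈ φ.FV, σ x = τ x) :
    φ.msubst σ = φ.msubst τ := by
  induction φ generalizing σ τ with
  | atom p t => simp only [msubst]; congr 1; ext i; exact h _ ⟨i, rfl⟩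
  | eq e a b => simp only [msubst]; rw [h a (by simp [FV]), h b (by simp [FV])]
  | neg φ ih => simp only [msubst]; rw [ih h]
  | conj φ ψ ih₁ ih₂ =>
    simp only [msubst]; rw [ih₁ fun x hx => h x (Or.inl hx), ih₂ fun x hx => h x (Or.inr hx)]
  | know φ ih => simp only [msubst]; rw [ih h]
  | wh z φ ih =>
    simp only [msubst]
    rw [ih]
    intro x hx
    by_cases e : x = z
    · simp [e]
    · simpa [e] using h x ⟨hx, e⟩

theorem msubst_id (φ : Formula ar X op ident) : φ.msubst id = φ := by
  induction φ with
  | atom p t => rfl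
  | eq e a b => rfl
  | neg φ ih => simp [msubst, ih]
  | conj φ ψ ih₁ ih₂ => simp [msubst, ih₁, ih₂]
  | know φ ih => simp [msubst, ih]
  | wh z φ ih =>
    simp only [msubst]
    rw [show Function.update (id : X → X) z z = id from Function.update_eq_self z id, ih]

theorem BV_msubst (σ : X → X) (φ : Formula ar X op ident) : (φ.msubst σ).BV = φ.BV := by
  induction φ generalizing σ with
  | atom p t => rfl
  | eq e a b => rfl
  | neg φ ih => exact ih σ
  | conj φ ψ ih₁ ih₂ => simp [msubst, BV, ih₁, ih₂]
  | know φ ih => exact ih σ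
  | wh z φ ih => simp [msubst, BV, ih]

/-- Since no other variable is sent to `x`, the occurrences of `x` left after fixing `x` are exactly
the original ones. This turns the body of a bundled operator, instantiated at `a`, into a parallel
substitution again, as the induction in the truth lemma requires. -/
theorem subst_msubst_update {σ : X → X} {x a : X} {φ : Formula ar X op ident}
    (h : ∀ u, u ≠ x → σ u ≠ x) :
    (φ.msubst (Function.update σ x x)).subst x a = φ.msubst (Function.update σ x a) := by
  have key : ∀ u, (if Function.update σ x x u = x then a else Function.update σ x x u) =
      Function.update σ x a u := by
    intro u
    by_cases e : u = x
    · simp [e]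
    · simp [e, h u e]
  induction φ generalizing σ with
  | atom p t => simp [msubst, subst, key]
  | eq e b c => simp [msubst, subst, key]
  | neg φ ih => simp [msubst, subst, ih h key]
  | conj φ ψ ih₁ ih₂ => simp [msubst, subst, ih₁ h key, ih₂ h key]
  | know φ ih => simp [msubst, subst, ih h key]
  | wh z φ ih =>
    simp only [msubst, subst]
    split_ifs with e
    · subst e; simp
    · have h' : ∀ u, u ≠ x → Function.update σ z z u ≠ x := by
        intro u hu
        by_cases e' : u = z
        · simpa [e'] using e
        · simpa [e'] using h u hu
      rw [Function.update_comm (Ne.symm e), Function.update_comm (Ne.symm e), ih h']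
      intro u
      by_cases e' : u = x
      · simp [e']
      · simp [e', h' u e']

/-- Formulas are stratified by height; each stratum is obtained from the previous one by finitely
many countable operations. -/
instance countable [Countable P] [Countable X] : Countable (Formula ar X op ident) := by
  let S : ℕ → Set (Formula ar X op ident) := fun n => Nat.rec
    (Set.range (fun q : Σ p : P, Fin (ar p) → X => atom q.1 q.2) ∪
      Set.range fun q : PLift (ident = true) × X × X => eq q.1.down q.2.1 q.2.2)
    (fun _ s => s ∪ neg '' s ∪ Set.image2 conj s s ∪ know '' s ∪ Set.image2 wh Set.univ s) n
  have hc : ∀ n, (S n).Countable := by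
    intro n
    induction n with
    | zero => exact (Set.countable_range _).union (Set.countable_range _)
    | succ n ih =>
      exact (((ih.union (ih.image _)).union (ih.image2 ih _)).union (ih.image _)).union
        ((Set.to_countable _).image2 ih _)
  have hm : Monotone S := monotone_nat_of_le_succ fun n φ h => by
    exact Or.inl (Or.inl (Or.inl (Or.inl h)))
  have hall : ∀ φ : Formula ar X op ident, ∃ n, φ ∈ S n := by
    intro φ
    induction φ with
    | atom p t => exact ⟨0, Or.inl ⟨⟨p, t⟩, rfl⟩⟩
    | eq h a b => exact ⟨0, Or.inr ⟨⟨⟨h⟩, a, b⟩, rfl⟩⟩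
    | neg φ ih =>
      obtain ⟨n, hn⟩ := ih
      exact ⟨n + 1, Or.inl (Or.inl (Or.inl (Or.inr ⟨φ, hn, rfl⟩)))⟩
    | conj φ ψ ih₁ ih₂ =>
      obtain ⟨n, hn⟩ := ih₁
      obtain ⟨m, hm'⟩ := ih₂
      exact ⟨max n m + 1, Or.inl (Or.inl (Or.inr
        ⟨φ, hm (le_max_left n m) hn, ψ, hm (le_max_right n m) hm', rfl⟩))⟩
    | know φ ih =>
      obtain ⟨n, hn⟩ := ih
      exact ⟨n + 1, Or.inl (Or.inr ⟨φ, hn, rfl⟩)⟩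
    | wh x φ ih =>
      obtain ⟨n, hn⟩ := ih
      exact ⟨n + 1, Or.inr ⟨x, trivial, φ, hn, rfl⟩⟩
  rw [← Set.countable_univ_iff]
  refine (Set.countable_iUnion hc).mono fun φ _ => ?_
  obtain ⟨n, hn⟩ := hall φ
  exact Set.mem_iUnion.2 ⟨n, hn⟩

end Formula

end KnowWh

namespace KnowWh

open Formula

/-! ### Soundness. -/

namespace KripkeModel

variable {P : Type u} {ar : P → ℕ} {X : Type v} [DecidableEq X] {op : WhOp} {ident : Bool}

theorem sat_imp (M : KripkeModel.{u, w₁, w₂} ar) (φ ψ : Formula ar X op ident) (w : M.W)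
    (σ : X → M.D) : M.Sat (imp φ ψ) w σ ↔ (M.Sat φ w σ → M.Sat ψ w σ) := by
  simp [imp, Sat]

/-- Satisfaction only depends on the values of the free variables. -/
theorem sat_congr (M : KripkeModel.{u, w₁, w₂} ar) {φ : Formula ar X op ident} {w : M.W}
    {σ τ : X → M.D} (h : ∀ x ∈ φ.FV, σ x = τ x) : M.Sat φ w σ ↔ M.Sat φ w τ := by
  induction φ generalizing w σ τ with
  | atom p t =>
    simp only [Sat]
    rw [show (fun i => σ (t i)) = fun i => τ (t i) from funext fun i => h _ ⟨i, rfl⟩]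
  | eq e a b => simp only [Sat]; rw [h a (by simp [FV]), h b (by simp [FV])]
  | neg φ ih => simp only [Sat]; rw [ih h]
  | conj φ ψ ih₁ ih₂ =>
    simp only [Sat]; rw [ih₁ fun x hx => h x (Or.inl hx), ih₂ fun x hx => h x (Or.inr hx)]
  | know φ ih => simp only [Sat, Knows, ih h]
  | wh z φ ih =>
    have : (fun (a : M.D) v => M.Sat φ v (Function.update σ z a)) =
        fun a v => M.Sat φ v (Function.update τ z a) := by
      funext a v
      refine propext (ih fun x hx => ?_)
      by_cases e : x = z
      · simp [e]
      · simpa [e] using h x ⟨hx, e⟩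
    simp only [Sat, this]

theorem sat_subst (M : KripkeModel.{u, w₁, w₂} ar) {φ : Formula ar X op ident} {x y : X}
    (hφ : Admissible x y φ) (w : M.W) (σ : X → M.D) :
    M.Sat (φ.subst x y) w σ ↔ M.Sat φ w (Function.update σ x (σ y)) := by
  have key : ∀ u, σ (if u = x then y else u) = Function.update σ x (σ y) u := by
    intro u
    by_cases e : u = x <;> simp [e]
  induction φ generalizing w σ with
  | atom p t => simp [Sat, subst, key]
  | eq e a b => simp [Sat, subst, key]
  | neg φ ih => exact not_congr (ih hφ w σ key)
  | conj φ ψ ih₁ ih₂ => exact and_congr (ih₁ hφ.1 w σ key) (ih₂ hφ.2 w σ key)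
  | know φ ih => simp only [subst, Sat, Knows, ih hφ _ _ key]
  | wh z φ ih =>
    by_cases hx : x ∈ (wh z φ).FV
    · obtain ⟨hzy, hA⟩ := hφ.resolve_left (not_not.2 hx)
      have hzx : z ≠ x := fun e => hx.2 e.symm
      have : (fun (a : M.D) v => M.Sat (φ.subst x y) v (Function.update σ z a)) =
          fun a v => M.Sat φ v (Function.update (Function.update σ x (σ y)) z a) := by
        funext a v
        refine (propext (ih hA v (Function.update σ z a) fun u => ?_)).trans ?_
        · by_cases e : u = x <;> simp [e]
        · rw [Function.update_comm (Ne.symm hzx), Function.update_of_ne (Ne.symm hzy)]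
      simp only [subst, if_neg hzx, Sat, this]
    · rw [subst_of_notMem_FV hx]
      refine M.sat_congr fun u hu => ?_
      rw [Function.update_of_ne]
      rintro rfl
      exact hx hu

/-- The common semantic content of the four rules. The premises of the chain ignore `x`, and the
object `a` exists at every world, so the universal quantifier over `a` can be pushed through all
boxes to the end of the chain. -/
theorem sat_chain_of_forall (M : KripkeModel.{u, w₁, w₂} ar) {x : X}
    {χ χ' : Formula ar X op ident} {σ : X → M.D}
    (h : ∀ w, (∀ a, M.Sat χ w (Function.update σ x a)) → M.Sat χ' w σ)
    {ψ : Formula ar X op ident} {l : List (Formula ar X op ident)}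
    (hx : ∀ θ ∈ ψ :: l, x ∉ FV θ) (w : M.W)
    (hc : ∀ a, M.Sat (chain ψ l χ) w (Function.update σ x a)) : M.Sat (chain ψ l χ') w σ := by
  have hfree : ∀ θ ∈ ψ :: l, ∀ w a, M.Sat θ w (Function.update σ x a) ↔ M.Sat θ w σ :=
    fun θ hθ w a => M.sat_congr fun u hu => by
      rw [Function.update_of_ne]
      rintro rfl
      exact hx _ hθ hu
  induction l generalizing ψ w with
  | nil =>
    simp only [chain, sat_imp] at hc ⊢
    exact fun hψ => h w fun a => hc a ((hfree ψ (by simp) w a).2 hψ)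
  | cons ψ' l ih =>
    simp only [chain, sat_imp] at hc ⊢
    intro hψ v hv
    exact ih (fun θ hθ => hx θ (List.mem_cons_of_mem _ hθ)) v
      (fun a => hc a ((hfree ψ (by simp) w a).2 hψ) v hv)
      fun θ hθ => hfree θ (List.mem_cons_of_mem _ hθ)

/-- In an `S4.2`-model every world has a successor at which exactly the believed propositions
are known. -/
theorem IsS42.exists_final {M : KripkeModel.{u, w₁, w₂} ar} (hM : M.IsS42) (w : M.W) :
    ∃ u, M.R w u ∧ ∀ v, M.R w v → M.R v u ∧ ∀ p, M.Believes p v → M.Knows p u := by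
  obtain ⟨u, hu⟩ := hM.conv w
  refine ⟨u, hu w (hM.refl w), fun v hv => ⟨hu v hv, fun p hp => ?_⟩⟩
  obtain ⟨v', h⟩ := not_forall.1 hp
  obtain ⟨hvv', h⟩ := Classical.not_imp.1 h
  have h : M.Knows p v' := not_not.1 h
  exact fun t ht => h t (hM.trans _ _ _ (hu v' (hM.trans _ _ _ hv hvv')) ht)

theorem IsS42.believes_of_knows {M : KripkeModel.{u, w₁, w₂} ar} (hM : M.IsS42) {p : M.W → Prop}
    {w : M.W} (h : M.Knows p w) : M.Believes p w := fun h' => h' w (hM.refl w) h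

/-- Theorems are valid in all `S4.2`-models. -/
theorem IsS42.sat_of_provable {M : KripkeModel.{u, w₁, w₂} ar} (hM : M.IsS42)
    {φ : Formula ar X op ident} (h : Provable φ) (w : M.W) (σ : X → M.D) : M.Sat φ w σ := by
  induction h generalizing w σ with
  | taut φ h => exact h (fun ψ => M.Sat ψ w σ) (fun _ => Iff.rfl) fun _ _ => Iff.rfl
  | axK φ ψ =>
    simp only [sat_imp]
    intro h₁ h₂ v hv
    exact (M.sat_imp _ _ _ _).1 (h₁ v hv) (h₂ v hv)
  | axT φ => exact (M.sat_imp _ _ _ _).2 fun h => h w (hM.refl w)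
  | ax4 φ =>
    exact (M.sat_imp _ _ _ _).2 fun h v hv u hu => h u (hM.trans _ _ _ hv hu)
  | ax2 φ =>
    refine (M.sat_imp _ _ _ _).2 fun h v hv => ?_
    obtain ⟨u, hwu, hu⟩ := hM.exists_final w
    exact fun h' => h' u (hu v hv).1 ((hu w (hM.refl w)).2 _ h u (hM.refl u))
  | mp φ ψ _ _ ih₁ ih₂ => exact (M.sat_imp _ _ _ _).1 (ih₁ w σ) (ih₂ w σ)
  | nec φ _ ih => exact fun v _ => ih v σ
  | TBtoKwh x y φ hop hφ =>
    subst hop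
    refine (M.sat_imp _ _ _ _).2 fun h => ⟨σ y, ?_⟩
    exact (M.sat_subst (φ := conj (bel φ) φ) ⟨hφ, hφ⟩ w σ).1 h
  | KtoKwh x y φ hop hφ =>
    subst hop
    refine (M.sat_imp _ _ _ _).2 fun h => ⟨σ y, ?_⟩
    exact fun v hv => (M.sat_subst hφ v σ).1 (h v hv)
  | KwhtoFS x y φ hop hφ =>
    refine (M.sat_imp _ _ _ _).2 fun h => ?_
    refine (M.sat_subst (φ := imp (bel φ) φ) ⟨hφ, hφ⟩ w σ).2 ((M.sat_imp _ _ _ _).2 ?_)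
    rcases hop with rfl | rfl <;> exact h.2 (σ y)
  | BtoBKwh x y φ hop hφ =>
    refine (M.sat_imp _ _ _ _).2 fun h => ?_
    obtain ⟨u, hwu, hu⟩ := hM.exists_final w
    have h₁ : M.Knows (fun v => M.Sat φ v (Function.update σ x (σ y))) u := fun v hv =>
      (M.sat_subst hφ v σ).1 ((hu w (hM.refl w)).2 _ h v hv)
    have h₂ : ∀ v, M.R u v → M.Knows (fun v => M.Sat φ v (Function.update σ x (σ y))) v :=
      fun v hv t ht => h₁ t (hM.trans _ _ _ hv ht)
    -- Beyond the final world `u` every belief is true, so the false-sensitivity clause costs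
    -- nothing.
    have h₃ : ∀ v, M.R u v → ∀ b, M.Believes (fun t => M.Sat φ t (Function.update σ x b)) v →
        M.Sat φ v (Function.update σ x b) :=
      fun v hv b hb => (hu v (hM.trans _ _ _ hwu hv)).2 _ hb v hv
    refine fun hn => hn u hwu fun v hv => ?_
    rcases hop with rfl | rfl
    · exact ⟨⟨σ y, hM.believes_of_knows (h₂ v hv), h₁ v hv⟩, h₃ v hv⟩
    · exact ⟨⟨σ y, h₂ v hv⟩, h₃ v hv⟩
  | KwhtoTB x φ ψ l hop hx _ ih =>
    refine M.sat_chain_of_forall (fun w h => ?_) hx w fun a => ih w _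
    rcases hop with rfl | rfl
    · rintro ⟨a, ha⟩; exact h a ha
    · rintro ⟨⟨a, ha⟩, -⟩; exact h a ha
  | KwhtoK x φ ψ l hop hx _ ih =>
    refine M.sat_chain_of_forall (fun w h => ?_) hx w fun a => ih w _
    rcases hop with rfl | rfl
    · rintro ⟨a, ha⟩; exact h a ha
    · rintro ⟨⟨a, ha⟩, -⟩; exact h a ha
  | FSBtoKwh x y φ ψ l hop hφ hx _ ih =>
    subst hop
    refine M.sat_chain_of_forall (fun w h => ?_) hx w fun a => ih w _
    simp only [sat_imp] at h ⊢
    intro hb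
    have hb' := (M.sat_subst (φ := bel φ) hφ w σ).1 hb
    exact ⟨⟨σ y, hb', h _ hb'⟩, h⟩
  | FSKtoKwh x y φ ψ l hop hφ hx _ ih =>
    subst hop
    refine M.sat_chain_of_forall (fun w h => ?_) hx w fun a => ih w _
    simp only [sat_imp] at h ⊢
    exact fun hb => ⟨⟨σ y, (M.sat_subst (φ := know φ) hφ w σ).1 hb⟩, h⟩
  | eqRefl h x => rfl
  | eqSubst h x y z φ hx hy =>
    simp only [sat_imp]
    intro e
    have e : σ x = σ y := e
    rw [M.sat_subst hx, M.sat_subst hy, e]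
    exact id
  | neKnow h x y => exact (M.sat_imp _ _ _ _).2 fun h _ _ => h

theorem sat_foldr_imp (M : KripkeModel.{u, w₁, w₂} ar) (l : List (Formula ar X op ident))
    (φ : Formula ar X op ident) (w : M.W) (σ : X → M.D) :
    M.Sat (l.foldr imp φ) w σ ↔ ((∀ γ ∈ l, M.Sat γ w σ) → M.Sat φ w σ) := by
  induction l with
  | nil => simp
  | cons a l ih => simp [sat_imp, ih]

end KripkeModel

theorem entails_of_derives {P : Type u} {ar : P → ℕ} {X : Type v} [DecidableEq X] {op : WhOp}
    {ident : Bool} {Γ : Set (Formula ar X op ident)} {φ : Formula ar X op ident}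
    (h : Derives Γ φ) : Entails.{u, v, w₁, w₂} Γ φ := by
  obtain ⟨l, hl, hp⟩ := h
  intro M hM w σ hΓ
  exact (M.sat_foldr_imp l φ w σ).1 (hM.sat_of_provable hp w σ) fun γ hγ => hΓ γ (hl γ hγ)

end KnowWh

namespace KnowWh

open Formula

/-! ### Ultraproducts of models -/

namespace KripkeModel

open Filter

variable {P : Type u} {ar : P → ℕ} {I : Type w₁}

/-- The ultraproduct of a family of models with respect to an ultrafilter; worlds that agree
almost everywhere are not identified. -/
def ultraproduct (U : Ultrafilter I) (M : I → KripkeModel.{u, w₁, w₂} ar) :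
    KripkeModel.{u, w₁, max w₁ w₂} ar where
  W := ∀ i, (M i).W
  D := (U : Filter I).Product fun i => (M i).D
  nonempty_W := ⟨fun i => (M i).nonempty_W.some⟩
  nonempty_D := ⟨Quotient.mk _ fun i => (M i).nonempty_D.some⟩
  R w v := ∀ᶠ i in U, (M i).R (w i) (v i)
  ρ p w := {d | ∃ t : Fin (ar p) → ∀ i, (M i).D, (∀ j, d j = Quotient.mk _ (t j)) ∧
    ∀ᶠ i in U, (fun j => t j i) ∈ (M i).ρ p (w i)}

variable {U : Ultrafilter I} {M : I → KripkeModel.{u, w₁, w₂} ar}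

theorem ultraproduct_isS42 (h : ∀ i, (M i).IsS42) : (ultraproduct U M).IsS42 where
  refl w := Eventually.of_forall fun i => (h i).refl (w i)
  trans w v u h₁ h₂ := by
    filter_upwards [h₁, h₂] with i h₁ h₂ using (h i).trans _ _ _ h₁ h₂
  conv w := by
    choose u hu using fun i => (h i).conv (w i)
    exact ⟨u, fun v hv => hv.mono fun i hi => hu i _ hi⟩

/-- Worlds are arbitrary choice functions, so a counterexample to knowledge is assembled from
counterexamples in the factors. -/
theorem ultraproduct_knows {p : (∀ i, (M i).W) → Prop} {q : ∀ i, (M i).W → Prop}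
    (h : ∀ v, p v ↔ ∀ᶠ i in U, q i (v i)) (w : ∀ i, (M i).W) :
    (ultraproduct U M).Knows p w ↔ ∀ᶠ i in U, (M i).Knows (q i) (w i) := by
  classical
  constructor
  · intro hp
    by_contra hn
    rw [← Ultrafilter.eventually_not] at hn
    have hv : ∀ i, ∃ v, ¬ (M i).Knows (q i) (w i) → (M i).R (w i) v ∧ ¬ q i v := by
      intro i
      by_cases hi : (M i).Knows (q i) (w i)
      -- A dummy value at the indices where knowledge holds; by `hn` these are negligible.
      · exact ⟨w i, fun h => absurd hi h⟩
      · obtain ⟨v, hv⟩ := not_forall.1 hi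
        exact ⟨v, fun _ => Classical.not_imp.1 hv⟩
    choose v hv using hv
    have h₁ := (h v).1 (hp v (hn.mono fun i hi => (hv i hi).1))
    obtain ⟨i, hi, hi'⟩ := (h₁.and hn).exists
    exact (hv i hi').2 hi
  · intro hq v hv
    refine (h v).2 ?_
    filter_upwards [hq, hv] with i hi hi' using hi _ hi'

theorem ultraproduct_believes {p : (∀ i, (M i).W) → Prop} {q : ∀ i, (M i).W → Prop}
    (h : ∀ v, p v ↔ ∀ᶠ i in U, q i (v i)) (w : ∀ i, (M i).W) :
    (ultraproduct U M).Believes p w ↔ ∀ᶠ i in U, (M i).Believes (q i) (w i) := by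
  unfold Believes
  rw [Ultrafilter.eventually_not]
  refine not_congr (ultraproduct_knows (fun v => ?_) w)
  rw [Ultrafilter.eventually_not]
  exact not_congr (ultraproduct_knows h v)

theorem ultraproduct_exists {p : (∀ i, (M i).D) → Prop} {q : ∀ i, (M i).D → Prop}
    (h : ∀ a, p a ↔ ∀ᶠ i in U, q i (a i)) :
    (∃ a, p a) ↔ ∀ᶠ i in U, ∃ a, q i a := by
  constructor
  · rintro ⟨a, ha⟩
    exact ((h a).1 ha).mono fun i hi => ⟨a i, hi⟩
  · intro hq
    have : ∀ i, ∃ a, (∃ a, q i a) → q i a := by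
      intro i
      by_cases hi : ∃ a, q i a
      · exact hi.imp fun a ha _ => ha
      · exact ⟨(M i).nonempty_D.some, fun h => absurd h hi⟩
    choose a ha using this
    exact ⟨a, (h a).2 (hq.mono ha)⟩

theorem ultraproduct_forall {p : (∀ i, (M i).D) → Prop} {q : ∀ i, (M i).D → Prop}
    (h : ∀ a, p a ↔ ∀ᶠ i in U, q i (a i)) :
    (∀ a, p a) ↔ ∀ᶠ i in U, ∀ a, q i a := by
  rw [← not_iff_not, ← Ultrafilter.eventually_not]
  simp only [not_forall]
  refine ultraproduct_exists fun a => ?_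
  rw [h, Ultrafilter.eventually_not]

/-- Objects are classes modulo the ultrafilter: `p'` is the property of classes and `p` its lift to
representatives, to which the pointwise argument applies. -/
theorem ultraproduct_knowsWh (op : WhOp) {p : (∀ i, (M i).D) → (∀ i, (M i).W) → Prop}
    {p' : (ultraproduct U M).D → (∀ i, (M i).W) → Prop} (hp : ∀ a, p' (Quotient.mk _ a) = p a)
    {q : ∀ i, (M i).D → (M i).W → Prop} (h : ∀ a v, p a v ↔ ∀ᶠ i in U, q i (a i) (v i))
    (w : ∀ i, (M i).W) :
    (ultraproduct U M).KnowsWh op p' w ↔ ∀ᶠ i in U, (M i).KnowsWh op (q i) (w i) := by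
  have hex : ∀ r : (ultraproduct U M).D → Prop, (∃ a, r a) ↔ ∃ a : ∀ i, (M i).D,
      r (Quotient.mk _ a) := fun r => Quotient.mk_surjective.exists
  have hall : ∀ r : (ultraproduct U M).D → Prop, (∀ a, r a) ↔ ∀ a : ∀ i, (M i).D,
      r (Quotient.mk _ a) := fun r => Quotient.mk_surjective.forall
  have hB : (∃ a, (ultraproduct U M).Believes (p' a) w ∧ p' a w) ↔
      ∀ᶠ i in U, ∃ a, (M i).Believes (q i a) (w i) ∧ q i a (w i) := by
    rw [hex]
    refine ultraproduct_exists (q := fun i a => (M i).Believes (q i a) (w i) ∧ q i a (w i))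
      fun a => ?_
    rw [hp, eventually_and]
    exact and_congr (ultraproduct_believes (h a) w) (h a w)
  have hK : (∃ a, (ultraproduct U M).Knows (p' a) w) ↔
      ∀ᶠ i in U, ∃ a, (M i).Knows (q i a) (w i) := by
    rw [hex]
    refine ultraproduct_exists (q := fun i a => (M i).Knows (q i a) (w i)) fun a => ?_
    rw [hp]
    exact ultraproduct_knows (h a) w
  have hF : (∀ b, (ultraproduct U M).Believes (p' b) w → p' b w) ↔
      ∀ᶠ i in U, ∀ b, (M i).Believes (q i b) (w i) → q i b (w i) := by
    rw [hall]
    refine ultraproduct_forall (q := fun i a => (M i).Believes (q i a) (w i) → q i a (w i))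
      fun a => ?_
    rw [hp, Ultrafilter.eventually_imp]
    exact imp_congr (ultraproduct_believes (h a) w) (h a w)
  cases op with
  | tB => exact hB
  | tBFS => exact (and_congr hB hF).trans eventually_and.symm
  | K => exact hK
  | KFS => exact (and_congr hK hF).trans eventually_and.symm

variable {X : Type v} [DecidableEq X] {op : WhOp} {ident : Bool}

/-- The theorem of Łoś. -/
theorem ultraproduct_sat (φ : Formula ar X op ident) (w : ∀ i, (M i).W)
    (σ : X → ∀ i, (M i).D) :
    (ultraproduct U M).Sat φ w (fun x => Quotient.mk _ (σ x)) ↔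
      ∀ᶠ i in U, (M i).Sat φ (w i) fun x => σ x i := by
  induction φ generalizing w σ with
  | atom p t =>
    constructor
    · rintro ⟨s, hs, h⟩
      have : ∀ᶠ i in U, ∀ j, σ (t j) i = s j i :=
        eventually_all.2 fun j => Quotient.exact (hs j)
      filter_upwards [h, this] with i hi hi'
      simpa only [Sat, hi'] using hi
    · exact fun h => ⟨fun j => σ (t j), fun _ => rfl, h⟩
  | eq e a b => exact Quotient.eq
  | neg φ ih =>
    simp only [Sat]
    rw [Ultrafilter.eventually_not]
    exact not_congr (ih w σ)
  | conj φ ψ ih₁ ih₂ => exact (and_congr (ih₁ w σ) (ih₂ w σ)).trans eventually_and.symm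
  | know φ ih => exact ultraproduct_knows (fun v => ih v σ) w
  | wh x φ ih =>
    refine ultraproduct_knowsWh op
      (p := fun a v => (ultraproduct U M).Sat φ v fun y => Quotient.mk _ (Function.update σ x a y))
      (fun a => ?_) (fun a v => (ih v (Function.update σ x a)).trans ?_) w
    · funext v
      exact congrArg ((ultraproduct U M).Sat φ v) (Function.comp_update (Quotient.mk _) σ x a).symm
    · refine eventually_congr (Eventually.of_forall fun i => iff_of_eq ?_)
      exact congrArg ((M i).Sat φ (v i))
        (Function.comp_update (fun b : ∀ i, (M i).D => b i) σ x a)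

end KripkeModel

/-- Strong completeness follows from weak completeness by compactness. -/
theorem derives_of_entails_of_weak {P : Type u} {ar : P → ℕ} {X : Type v} [DecidableEq X]
    {op : WhOp} {ident : Bool}
    (weak : ∀ φ : Formula ar X op ident, ¬ Provable φ →
      ∃ M : KripkeModel.{u, max u v, v} ar, M.IsS42 ∧ ∃ w σ, ¬ M.Sat φ w σ)
    {Γ : Set (Formula ar X op ident)} {φ : Formula ar X op ident}
    (h : Entails.{u, v, max u v, max u v} Γ φ) : Derives Γ φ := by
  by_contra hn
  have key : ∀ s : Finset Γ, ∃ M : KripkeModel.{u, max u v, v} ar, M.IsS42 ∧ ∃ w σ,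
      (∀ γ ∈ s, M.Sat γ.1 w σ) ∧ ¬ M.Sat φ w σ := by
    intro s
    have hs : ¬ Provable ((s.toList.map Subtype.val).foldr imp φ) := by
      refine fun hp => hn ⟨_, fun γ hγ => ?_, hp⟩
      obtain ⟨γ', -, rfl⟩ := List.mem_map.1 hγ
      exact γ'.2
    obtain ⟨M, hM, w, σ, hσ⟩ := weak _ hs
    rw [M.sat_foldr_imp] at hσ
    obtain ⟨h₁, h₂⟩ := Classical.not_imp.1 hσ
    exact ⟨M, hM, w, σ, fun γ hγ =>
      h₁ _ (List.mem_map.2 ⟨γ, Finset.mem_toList.2 hγ, rfl⟩), h₂⟩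
  choose M hM w σ h₁ h₂ using key
  -- Each `γ ∈ Γ` holds in the models indexed by finite sets containing `γ`, hence at `U`-almost all
  -- indices.
  let U : Ultrafilter (Finset Γ) := Ultrafilter.of Filter.atTop
  have hsat := h (KripkeModel.ultraproduct U M) (KripkeModel.ultraproduct_isS42 hM) w
    (fun x => Quotient.mk _ fun i => σ i x) fun γ hγ => by
      rw [KripkeModel.ultraproduct_sat γ w fun x i => σ i x]
      refine Filter.Eventually.filter_mono (Ultrafilter.of_le _) ?_
      filter_upwards [Filter.eventually_ge_atTop ({⟨γ, hγ⟩} : Finset Γ)] with s hs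
      exact h₁ s ⟨γ, hγ⟩ (hs (Finset.mem_singleton_self _))
  rw [KripkeModel.ultraproduct_sat φ w fun x i => σ i x] at hsat
  obtain ⟨i, hi⟩ := hsat.exists
  exact h₂ i hi

end KnowWh

namespace KnowWh

open Formula

/-! ### Embeddings of languages -/

namespace Formula

variable {P : Type u} {ar : P → ℕ} {T : Set P} {X : Type v} {Y : Type v} {op : WhOp}
  {ident : Bool}

/-- The translation of formulas over fewer predicate symbols along a map of variables. -/
def map (g : Y → X) : Formula (fun p : T => ar p) Y op ident → Formula ar X op ident
  | atom p t => atom p.1 fun i => g (t i)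
  | eq h x y => eq h (g x) (g y)
  | neg φ => neg (map g φ)
  | conj φ ψ => conj (map g φ) (map g ψ)
  | know φ => know (map g φ)
  | wh x φ => wh (g x) (map g φ)

variable {g : Y → X}

theorem FV_map (hg : g.Injective) (φ : Formula (fun p : T => ar p) Y op ident) :
    (φ.map g).FV = g '' φ.FV := by
  induction φ with
  | atom p t => exact Set.range_comp g t
  | eq h x y => simp [map, FV, Set.image_pair]
  | neg φ ih => exact ih
  | conj φ ψ ih₁ ih₂ => simp [map, FV, ih₁, ih₂, Set.image_union]
  | know φ ih => exact ih
  | wh x φ ih => simp [map, FV, ih, Set.image_sdiff hg]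

theorem Admissible.map (hg : g.Injective) {x y : Y} :
    ∀ {φ : Formula (fun p : T => ar p) Y op ident}, Admissible x y φ →
      Admissible (g x) (g y) (φ.map g)
  | atom _ _, _ => trivial
  | eq _ _ _, _ => trivial
  | neg φ, h => Admissible.map hg (φ := φ) h
  | conj φ ψ, h => ⟨Admissible.map hg h.1, Admissible.map hg h.2⟩
  | know φ, h => Admissible.map hg (φ := φ) h
  | wh z φ, h => by
    refine h.imp (fun h' => ?_) fun h' => ⟨hg.ne h'.1, Admissible.map hg h'.2⟩
    have := FV_map hg (wh z φ)
    rw [Formula.map] at this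
    rwa [this, hg.mem_set_image]

theorem map_chain (ψ : Formula (fun p : T => ar p) Y op ident) (l) (χ) :
    (chain ψ l χ).map g = chain (ψ.map g) (l.map (map g)) (χ.map g) := by
  induction l generalizing ψ with
  | nil => rfl
  | cons a l ih => simp [chain, imp, map, ih]

/-- Only the predicate symbols that occur in the formula are needed. Allowing every larger `T'` lets
the two halves of a conjunction be pulled back to the same language. -/
theorem exists_map_eq {φ : Formula ar X op ident} {S : Set X} :
    ∃ T : Set P, T.Countable ∧ (φ.FV ⊆ S → φ.BV ⊆ S →
      ∀ T', T ⊆ T' → ∃ φ' : Formula (fun p : T' => ar p) S op ident, φ'.map Subtype.val = φ) := by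
  induction φ with
  | atom p t =>
    refine ⟨{p}, Set.countable_singleton p, fun h _ T' hT => ?_⟩
    exact ⟨atom ⟨p, hT rfl⟩ fun i => ⟨t i, h ⟨i, rfl⟩⟩, rfl⟩
  | eq e a b =>
    refine ⟨∅, Set.countable_empty, fun h _ T' hT => ?_⟩
    exact ⟨eq e ⟨a, h (by simp [FV])⟩ ⟨b, h (by simp [FV])⟩, rfl⟩
  | neg φ ih =>
    obtain ⟨T, hT, h⟩ := ih
    refine ⟨T, hT, fun hF hB T' hT' => ?_⟩
    obtain ⟨φ', rfl⟩ := h hF hB T' hT'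
    exact ⟨neg φ', rfl⟩
  | conj φ ψ ih₁ ih₂ =>
    obtain ⟨T₁, hT₁, h₁⟩ := ih₁
    obtain ⟨T₂, hT₂, h₂⟩ := ih₂
    refine ⟨T₁ ∪ T₂, hT₁.union hT₂, fun hF hB T' hT' => ?_⟩
    rw [FV, Set.union_subset_iff] at hF
    rw [BV, Set.union_subset_iff] at hB
    rw [Set.union_subset_iff] at hT'
    obtain ⟨φ', rfl⟩ := h₁ hF.1 hB.1 T' hT'.1
    obtain ⟨ψ', rfl⟩ := h₂ hF.2 hB.2 T' hT'.2
    exact ⟨conj φ' ψ', rfl⟩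
  | know φ ih =>
    obtain ⟨T, hT, h⟩ := ih
    refine ⟨T, hT, fun hF hB T' hT' => ?_⟩
    obtain ⟨φ', rfl⟩ := h hF hB T' hT'
    exact ⟨know φ', rfl⟩
  | wh x φ ih =>
    obtain ⟨T, hT, h⟩ := ih
    refine ⟨T, hT, fun hF hB T' hT' => ?_⟩
    rw [BV, Set.insert_subset_iff] at hB
    have hF' : φ.FV ⊆ S := fun y hy => by
      by_cases e : y = x
      · exact e ▸ hB.1
      · exact hF ⟨hy, e⟩
    obtain ⟨φ', rfl⟩ := h hF' hB.2 T' hT'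
    exact ⟨wh ⟨x, hB.1⟩ φ', rfl⟩

variable [DecidableEq X] [DecidableEq Y]

theorem map_subst (hg : g.Injective) (x y : Y) (φ : Formula (fun p : T => ar p) Y op ident) :
    (φ.subst x y).map g = (φ.map g).subst (g x) (g y) := by
  induction φ with
  | atom p t => simp [map, subst, hg.eq_iff, apply_ite g]
  | eq h a b => simp [map, subst, hg.eq_iff, apply_ite g]
  | neg φ ih => simp [map, subst, ih]
  | conj φ ψ ih₁ ih₂ => simp [map, subst, ih₁, ih₂]
  | know φ ih => simp [map, subst, ih]
  | wh z φ ih =>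
    simp only [map, subst, hg.eq_iff]
    split_ifs <;> simp [map, ih]

end Formula

variable {P : Type u} {ar : P → ℕ} {T : Set P} {X : Type v} {Y : Type v} [DecidableEq X]
  [DecidableEq Y] {op : WhOp} {ident : Bool} {g : Y → X}

/-- All axioms and rules are schematic, and an injective renaming commutes with substitution and
preserves their side conditions. By contraposition, a formula unprovable in the full language is
unprovable in the sublanguage. -/
theorem Provable.map (hg : g.Injective) {φ : Formula (fun p : T => ar p) Y op ident}
    (h : Provable φ) : Provable (φ.map g) := by
  have hfree : ∀ {x : Y} {ψ : Formula (fun p : T => ar p) Y op ident} {l},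
      (∀ χ ∈ ψ :: l, x ∉ FV χ) → ∀ χ ∈ ψ.map g :: l.map (Formula.map g), g x ∉ FV χ := by
    intro x ψ l h χ hχ
    rw [← List.map_cons (f := Formula.map g)] at hχ
    obtain ⟨χ', hχ', rfl⟩ := List.mem_map.1 hχ
    rw [FV_map hg, hg.mem_set_image]
    exact h χ' hχ'
  induction h with
  | taut φ h =>
    exact .taut _ fun val h₁ h₂ => h (fun ψ => val (ψ.map g)) (fun ψ => h₁ _) fun ψ χ => h₂ _ _
  | axK φ ψ => exact .axK _ _
  | axT φ => exact .axT _
  | ax4 φ => exact .ax4 _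
  | ax2 φ => exact .ax2 _
  | mp φ ψ _ _ ih₁ ih₂ => exact .mp _ _ ih₁ ih₂
  | nec φ _ ih => exact .nec _ ih
  | TBtoKwh x y φ hop hφ =>
    have := Provable.TBtoKwh (g x) (g y) (φ.map g) hop (hφ.map hg)
    have e := map_subst hg x y (conj (bel φ) φ)
    simp only [Formula.map, bel, poss] at e
    simp only [bel, poss] at this
    rw [← e] at this
    exact this
  | KtoKwh x y φ hop hφ =>
    have := Provable.KtoKwh (g x) (g y) (φ.map g) hop (hφ.map hg)
    rw [← map_subst hg] at this
    exact this
  | KwhtoFS x y φ hop hφ =>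
    have := Provable.KwhtoFS (g x) (g y) (φ.map g) hop (hφ.map hg)
    have e := map_subst hg x y (imp (bel φ) φ)
    simp only [Formula.map, bel, poss, imp] at e
    simp only [bel, poss, imp] at this
    rw [← e] at this
    exact this
  | BtoBKwh x y φ hop hφ =>
    have := Provable.BtoBKwh (g x) (g y) (φ.map g) hop (hφ.map hg)
    rw [← map_subst hg] at this
    exact this
  | KwhtoTB x φ ψ l hop hx _ ih =>
    rw [map_chain] at ih ⊢
    exact .KwhtoTB _ _ _ _ hop (hfree hx) ih
  | KwhtoK x φ ψ l hop hx _ ih =>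
    rw [map_chain] at ih ⊢
    exact .KwhtoK _ _ _ _ hop (hfree hx) ih
  | FSBtoKwh x y φ ψ l hop hφ hx _ ih =>
    rw [map_chain] at ih ⊢
    have := Provable.FSBtoKwh (g x) (g y) (φ.map g) _ _ hop (hφ.map hg) (hfree hx) ih
    rw [← map_subst hg] at this
    exact this
  | FSKtoKwh x y φ ψ l hop hφ hx _ ih =>
    rw [map_chain] at ih ⊢
    have := Provable.FSKtoKwh (g x) (g y) (φ.map g) _ _ hop (hφ.map hg) (hfree hx) ih
    rw [← map_subst hg] at this
    exact this
  | eqRefl h x => exact .eqRefl h _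
  | eqSubst h x y z φ hx hy =>
    have := Provable.eqSubst h (g x) (g y) (g z) (φ.map g) (hx.map hg) (hy.map hg)
    rw [← map_subst hg, ← map_subst hg] at this
    exact this
  | neKnow h x y => exact .neKnow h _ _

namespace KripkeModel

/-- Interpret the predicate symbols outside `T` by the empty relation. -/
def extend (M : KripkeModel.{u, w₁, w₂} fun p : T => ar p) : KripkeModel.{u, w₁, w₂} ar where
  W := M.W
  D := M.D
  nonempty_W := M.nonempty_W
  nonempty_D := M.nonempty_D
  R := M.R
  ρ p w := {d | ∃ h : p ∈ T, d ∈ M.ρ ⟨p, h⟩ w}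

theorem IsS42.extend {M : KripkeModel.{u, w₁, w₂} fun p : T => ar p} (h : M.IsS42) :
    M.extend.IsS42 := ⟨h.refl, h.trans, h.conv⟩

theorem extend_sat (hg : g.Injective) (M : KripkeModel.{u, w₁, w₂} fun p : T => ar p)
    (φ : Formula (fun p : T => ar p) Y op ident) (w : M.W) (σ : X → M.D) :
    M.extend.Sat (φ.map g) w σ ↔ M.Sat φ w (σ ∘ g) := by
  induction φ generalizing w σ with
  | atom p t => exact ⟨fun ⟨_, h⟩ => h, fun h => ⟨p.2, h⟩⟩
  | eq h a b => exact Iff.rfl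
  | neg φ ih => exact not_congr (ih w σ)
  | conj φ ψ ih₁ ih₂ => exact and_congr (ih₁ w σ) (ih₂ w σ)
  | know φ ih => exact forall_congr' fun v => imp_congr Iff.rfl (ih v σ)
  | wh x φ ih =>
    have : (fun (a : M.D) v => M.extend.Sat (φ.map g) v (Function.update σ (g x) a)) =
        fun a v => M.Sat φ v (Function.update (σ ∘ g) x a) := by
      funext a v
      rw [← Function.update_comp_eq_of_injective σ hg]
      exact propext (ih v _)
    change M.extend.KnowsWh op (fun (a : M.D) v =>
      M.extend.Sat (φ.map g) v (Function.update σ (g x) a)) w ↔ _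
    rw [this]
    cases op <;> exact Iff.rfl

end KripkeModel

/-- Weak completeness follows from weak completeness for countable languages. -/
theorem exists_countermodel_of_countable {P : Type u} {ar : P → ℕ} {X : Type v} [DecidableEq X]
    [Infinite X] {op : WhOp} {ident : Bool}
    (weak : ∀ (T : Set P) (S : Set X), Countable T → Countable S → Infinite S →
      ∀ φ : Formula (fun p : T => ar p) S op ident, ¬ Provable φ →
        ∃ M : KripkeModel.{u, max u v, v} (fun p : T => ar p), M.IsS42 ∧ ∃ w σ, ¬ M.Sat φ w σ)
    (φ : Formula ar X op ident) (hφ : ¬ Provable φ) :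
    ∃ M : KripkeModel.{u, max u v, v} ar, M.IsS42 ∧ ∃ w σ, ¬ M.Sat φ w σ := by
  -- Infinitely many spare variables, to serve as objects and fresh variables in the sublanguage.
  let N : Set X := Set.range (Infinite.natEmbedding X)
  let S : Set X := φ.FV ∪ φ.BV ∪ N
  have hS : S.Countable :=
    ((finite_FV φ).countable.union (finite_BV φ).countable).union (Set.countable_range _)
  have hS' : S.Infinite :=
    (Set.infinite_range_of_injective (Infinite.natEmbedding X).injective).mono
      Set.subset_union_right
  obtain ⟨T, hT, h⟩ := exists_map_eq (φ := φ) (S := S)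
  obtain ⟨φ', hφ'⟩ := h (fun x hx => Or.inl (Or.inl hx)) (fun x hx => Or.inl (Or.inr hx)) T
    subset_rfl
  have hinj : Function.Injective (Subtype.val : S → X) := Subtype.val_injective
  obtain ⟨M, hM, w, σ, hσ⟩ := weak T S hT.to_subtype hS.to_subtype hS'.to_subtype φ'
    fun hp => hφ (hφ' ▸ hp.map hinj)
  have := M.nonempty_D
  let τ : X → M.D := Function.extend Subtype.val σ fun _ => this.some
  have hτ : τ ∘ Subtype.val = σ := Function.extend_comp hinj _ _
  refine ⟨M.extend, hM.extend, w, τ, ?_⟩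
  rw [← hφ']
  intro hs
  have hs' := (KripkeModel.extend_sat hinj M φ' w τ).1 hs
  rw [hτ] at hs'
  exact hσ hs'

end KnowWh

namespace KnowWh

open Formula

/-! ### Maximal consistent sets -/

variable {P : Type u} {ar : P → ℕ} {X : Type v} [DecidableEq X] {op : WhOp} {ident : Bool}

/-- Sets of formulas that contain all theorems and are closed under modus ponens. -/
structure IsTheory (T : Set (Formula ar X op ident)) : Prop where
  thm : ∀ {φ}, Provable φ → φ ∈ T
  mp : ∀ {φ ψ}, imp φ ψ ∈ T → φ ∈ T → ψ ∈ T

/-- Maximal consistent sets: valuations that contain all theorems. -/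
structure IsMCS (w : Set (Formula ar X op ident)) : Prop where
  thm : ∀ {φ}, Provable φ → φ ∈ w
  neg_mem : ∀ {φ}, neg φ ∈ w ↔ φ ∉ w
  conj_mem : ∀ {φ ψ}, conj φ ψ ∈ w ↔ φ ∈ w ∧ ψ ∈ w

theorem isTheory_provable : IsTheory {φ : Formula ar X op ident | Provable φ} :=
  ⟨id, fun h₁ h₂ => .mp _ _ h₁ h₂⟩

namespace IsTheory

variable {T : Set (Formula ar X op ident)}

theorem of_taut (hT : IsTheory T) {φ ψ : Formula ar X op ident} (h : IsTautology (imp φ ψ))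
    (hφ : φ ∈ T) : ψ ∈ T :=
  hT.mp (hT.thm (.taut _ h)) hφ

theorem of_taut₂ (hT : IsTheory T) {φ ψ χ : Formula ar X op ident}
    (h : IsTautology (imp φ (imp ψ χ))) (hφ : φ ∈ T) (hψ : ψ ∈ T) : χ ∈ T :=
  hT.mp (hT.of_taut h hφ) hψ

end IsTheory

theorem Provable.imp_trans {φ ψ χ : Formula ar X op ident} (h₁ : Provable (imp φ ψ))
    (h₂ : Provable (imp ψ χ)) : Provable (imp φ χ) :=
  isTheory_provable.of_taut₂ (fun v hn hc => by simp only [imp, hn, hc]; tauto) h₁ h₂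

/-- Every formula consistent with a theory belongs to a maximal consistent extension of the theory
that meets countably many given dense requirements. -/
theorem IsTheory.exists_isMCS_generic [Countable P] [Countable X]
    {T : Set (Formula ar X op ident)} (hT : IsTheory T) {ι : Type*} [Countable ι]
    {D : ι → Set (Formula ar X op ident)}
    (hD : ∀ i θ, neg θ ∉ T → ∃ θ', neg θ' ∉ T ∧ Provable (imp θ' θ) ∧ θ' ∈ D i)
    {θ₀ : Formula ar X op ident} (h₀ : neg θ₀ ∉ T) :
    ∃ w, IsMCS w ∧ T ⊆ w ∧ θ₀ ∈ w ∧ ∀ i, ∃ θ ∈ w, θ ∈ D i := by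
  -- A Rasiowa–Sikorski argument: the conditions are formulas consistent with `T`, ordered by
  -- provable implication. Besides the given dense sets, `E` asks that each formula be decided; `w`
  -- will be the filter generated by a descending sequence `s` meeting all of them.
  let E : Formula ar X op ident ⊕ ι → Set (Formula ar X op ident) := Sum.elim
    (fun ψ => {θ | Provable (imp θ ψ) ∨ Provable (imp θ (neg ψ))}) D
  have hE : ∀ j (θ : {θ // neg θ ∉ T}), ∃ θ' : {θ // neg θ ∉ T},
      Provable (imp θ'.1 θ.1) ∧ θ'.1 ∈ E j := by
    rintro (ψ | i) ⟨θ, hθ⟩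
    · have h₁ : Provable (imp (conj θ ψ) θ) :=
        .taut _ fun v hn hc => by simp only [imp, hn, hc]; tauto
      have h₁' : Provable (imp (conj θ ψ) ψ) :=
        .taut _ fun v hn hc => by simp only [imp, hn, hc]; tauto
      have h₂ : Provable (imp (conj θ (neg ψ)) θ) :=
        .taut _ fun v hn hc => by simp only [imp, hn, hc]; tauto
      have h₂' : Provable (imp (conj θ (neg ψ)) (neg ψ)) :=
        .taut _ fun v hn hc => by simp only [imp, hn, hc]; tauto
      by_cases h : neg (conj θ ψ) ∈ T
      · refine ⟨⟨conj θ (neg ψ), fun h' => hθ ?_⟩, h₂, Or.inr h₂'⟩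
        exact hT.of_taut₂ (fun v hn hc => by simp only [imp, hn, hc]; tauto) h h'
      · exact ⟨⟨conj θ ψ, h⟩, h₁, Or.inl h₁'⟩
    · obtain ⟨θ', h₁, h₂, h₃⟩ := hD i θ hθ
      exact ⟨⟨θ', h₁⟩, h₂, h₃⟩
  choose f hf hfE using hE
  have : Nonempty (Formula ar X op ident ⊕ ι) := ⟨Sum.inl θ₀⟩
  obtain ⟨e, he⟩ := exists_surjective_nat (Formula ar X op ident ⊕ ι)
  let s : ℕ → {θ // neg θ ∉ T} := fun n => Nat.rec ⟨θ₀, h₀⟩ (fun n θ => f (e n) θ) n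
  have hs : ∀ {m n}, m ≤ n → Provable (imp (s n).1 (s m).1) := by
    intro m n hmn
    induction n, hmn using Nat.le_induction with
    | base => exact .taut _ fun v hn hc => by simp only [imp, hn, hc]; tauto
    | succ n _ ih => exact (hf (e n) (s n)).imp_trans ih
  have hsE : ∀ j, ∃ n, (s n).1 ∈ E j := fun j => by
    obtain ⟨n, rfl⟩ := he j
    exact ⟨n + 1, hfE (e n) (s n)⟩
  have hlift : ∀ {m n ψ}, m ≤ n → Provable (imp (s m).1 ψ) → Provable (imp (s n).1 ψ) :=
    fun hmn h => (hs hmn).imp_trans h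
  have hcon : ∀ n ψ, neg ψ ∈ T → ¬ Provable (imp (s n).1 ψ) := fun n ψ hψ h => (s n).2
    (hT.of_taut₂ (fun v hn hc => by simp only [imp, hn, hc]; tauto) hψ (hT.thm h))
  have hself : ∀ n, Provable (imp (s n).1 (s n).1) := fun n => hs le_rfl
  have hdec : ∀ ψ, ∃ n, Provable (imp (s n).1 ψ) ∨ Provable (imp (s n).1 (neg ψ)) :=
    fun ψ => hsE (Sum.inl ψ)
  refine ⟨{ψ | ∃ n, Provable (imp (s n).1 ψ)}, ⟨fun h => ⟨0, ?_⟩, ?_, ?_⟩, ?_, ⟨0, hself 0⟩, ?_⟩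
  · exact isTheory_provable.of_taut (fun v hn hc => by simp only [imp, hn, hc]; tauto) h
  · intro φ
    refine ⟨?_, fun h => ?_⟩
    · rintro ⟨m, hm⟩ ⟨n, hn⟩
      refine hcon (max m n) (conj φ (neg φ)) (hT.thm (.taut _ fun v hn hc => by
        simp only [hn, hc]; tauto)) ?_
      exact isTheory_provable.of_taut₂ (fun v hn hc => by simp only [imp, hn, hc]; tauto)
        (hlift (le_max_left m n) hm) (hlift (le_max_right m n) hn)
    · obtain ⟨n, hn | hn⟩ := hdec φ
      · exact absurd ⟨n, hn⟩ h
      · exact ⟨n, hn⟩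
  · intro φ ψ
    refine ⟨fun ⟨n, hn⟩ => ⟨⟨n, ?_⟩, ⟨n, ?_⟩⟩, fun ⟨⟨m, hm⟩, ⟨n, hn⟩⟩ => ⟨max m n, ?_⟩⟩
    · exact isTheory_provable.of_taut (fun v hn hc => by simp only [imp, hn, hc]; tauto) hn
    · exact isTheory_provable.of_taut (fun v hn hc => by simp only [imp, hn, hc]; tauto) hn
    · exact isTheory_provable.of_taut₂ (fun v hn hc => by simp only [imp, hn, hc]; tauto)
        (hlift (le_max_left m n) hm) (hlift (le_max_right m n) hn)
  · intro ψ hψ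
    obtain ⟨n, hn | hn⟩ := hdec ψ
    · exact ⟨n, hn⟩
    · exact absurd hn (hcon n _ (hT.of_taut (fun v hn hc => by
        simp only [imp, hn, hc]; tauto) hψ))
  · intro i
    obtain ⟨n, hn⟩ := hsE (Sum.inr i)
    exact ⟨_, ⟨n, hself n⟩, hn⟩

theorem IsTheory.exists_isMCS [Countable P] [Countable X] {T : Set (Formula ar X op ident)}
    (hT : IsTheory T) {θ : Formula ar X op ident} (h : neg θ ∉ T) :
    ∃ w, IsMCS w ∧ T ⊆ w ∧ θ ∈ w := by
  obtain ⟨w, h₁, h₂, h₃, -⟩ := hT.exists_isMCS_generic (ι := Empty) (D := fun _ => ∅)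
    (fun i => i.elim) h
  exact ⟨w, h₁, h₂, h₃⟩

/-- The canonical accessibility relation. -/
def Acc (w v : Set (Formula ar X op ident)) : Prop := ∀ φ, know φ ∈ w → φ ∈ v

namespace IsMCS

variable {w v : Set (Formula ar X op ident)}

theorem imp_mem (hw : IsMCS w) {φ ψ : Formula ar X op ident} :
    imp φ ψ ∈ w ↔ (φ ∈ w → ψ ∈ w) := by
  rw [imp, hw.neg_mem, hw.conj_mem, hw.neg_mem]; tauto

theorem mem_of_provable (hw : IsMCS w) {φ ψ : Formula ar X op ident} (h : Provable (imp φ ψ))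
    (hφ : φ ∈ w) : ψ ∈ w := hw.imp_mem.1 (hw.thm h) hφ

theorem isTheory_know (hw : IsMCS w) : IsTheory {φ | know φ ∈ w} :=
  ⟨fun h => hw.thm (.nec _ h), fun h₁ h₂ => hw.imp_mem.1 (hw.mem_of_provable (.axK _ _) h₁) h₂⟩

theorem acc_refl (hw : IsMCS w) : Acc w w := fun _ h => hw.mem_of_provable (.axT _) h

theorem know_know (hw : IsMCS w) {φ : Formula ar X op ident} (h : know φ ∈ w) :
    know (know φ) ∈ w := hw.mem_of_provable (.ax4 _) h

theorem acc_trans (hw : IsMCS w) {u : Set (Formula ar X op ident)} (h₁ : Acc w v)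
    (h₂ : Acc v u) : Acc w u := fun _ h => h₂ _ (h₁ _ (hw.know_know h))

/-- Axiom 4 under the diamond gives `⟨K⟩[K][K]φ`, and axiom .2 turns this into `[K]⟨K⟩[K]φ`.
Together with `bel_of_acc'`, beliefs are the same at a world and at its successors. -/
theorem bel_of_acc (hw : IsMCS w) (h : Acc w v) {φ : Formula ar X op ident} (hφ : bel φ ∈ w) :
    bel φ ∈ v := by
  refine h _ (hw.mem_of_provable (.ax2 _) ?_)
  simp only [bel, poss, hw.neg_mem] at hφ ⊢
  refine fun h' => hφ (hw.isTheory_know.mp (hw.thm (.nec _ ?_)) h')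
  exact isTheory_provable.of_taut (fun v hn hc => by simp only [imp, hn, hc]; tauto)
    (Provable.ax4 φ)

variable [Countable P] [Countable X]

theorem know_mem (hw : IsMCS w) {φ : Formula ar X op ident} :
    know φ ∈ w ↔ ∀ v, IsMCS v → Acc w v → φ ∈ v := by
  refine ⟨fun h v _ hv => hv φ h, fun h => ?_⟩
  by_contra hn
  obtain ⟨v, hv, hwv, hφ⟩ := hw.isTheory_know.exists_isMCS (θ := neg φ) fun h' => hn
    (hw.isTheory_know.of_taut (fun v hn hc => by simp only [imp, hn, hc]; tauto) h')
  exact hv.neg_mem.1 hφ (h v hv hwv)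

theorem bel_mem (hw : IsMCS w) {φ : Formula ar X op ident} :
    bel φ ∈ w ↔ ∃ v, IsMCS v ∧ Acc w v ∧ know φ ∈ v := by
  rw [bel, poss, hw.neg_mem, hw.know_mem]
  push Not
  refine exists_congr fun v => and_congr_right fun hv => and_congr_right fun _ => ?_
  rw [hv.neg_mem, not_not]

theorem bel_of_acc' (hw : IsMCS w) (hv : IsMCS v) (h : Acc w v) {φ : Formula ar X op ident}
    (hφ : bel φ ∈ v) : bel φ ∈ w := by
  obtain ⟨t, ht, hvt, hφ⟩ := hv.bel_mem.1 hφ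
  exact hw.bel_mem.2 ⟨t, ht, hw.acc_trans h hvt, hφ⟩

theorem bel_of_know (hw : IsMCS w) {φ : Formula ar X op ident} (h : know φ ∈ w) : bel φ ∈ w :=
  hw.bel_mem.2 ⟨w, hw, hw.acc_refl, h⟩

theorem bel_know (hw : IsMCS w) {φ : Formula ar X op ident} (h : bel φ ∈ w) :
    bel (know φ) ∈ w := by
  obtain ⟨v, hv, hwv, hφ⟩ := hw.bel_mem.1 h
  exact hw.bel_mem.2 ⟨v, hv, hwv, hv.know_know hφ⟩

/-- Two beliefs become known at a common successor: go to a world that knows the first, where the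
second is still believed, and on to one that knows it. -/
theorem isTheory_bel (hw : IsMCS w) : IsTheory {φ | bel φ ∈ w} := by
  refine ⟨fun h => hw.bel_of_know (hw.thm (.nec _ h)), fun {φ ψ} h₁ h₂ => ?_⟩
  obtain ⟨v, hv, hwv, h₁⟩ := hw.bel_mem.1 h₁
  obtain ⟨t, ht, hvt, h₂⟩ := hv.bel_mem.1 (hw.bel_of_acc hwv h₂)
  refine hw.bel_mem.2 ⟨t, ht, hw.acc_trans hwv hvt, ?_⟩
  exact ht.isTheory_know.mp (hvt _ (hv.know_know h₁)) h₂

theorem bel_mono (hw : IsMCS w) {φ ψ : Formula ar X op ident} (h : Provable (imp φ ψ))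
    (hφ : bel φ ∈ w) : bel ψ ∈ w :=
  hw.isTheory_bel.mp (hw.isTheory_bel.thm h) hφ

theorem chain_mono (hw : IsMCS w) {χ χ' : Formula ar X op ident} (h : know (imp χ χ') ∈ w)
    {ψ : Formula ar X op ident} {l : List (Formula ar X op ident)} (hc : chain ψ l χ ∈ w) :
    chain ψ l χ' ∈ w := by
  induction l generalizing ψ w with
  | nil =>
    rw [chain, hw.imp_mem] at hc ⊢
    exact fun hψ => hw.imp_mem.1 (hw.acc_refl _ h) (hc hψ)
  | cons ψ' l ih =>
    rw [chain, hw.imp_mem, hw.know_mem] at hc ⊢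
    exact fun hψ v hv hwv => ih hv (hwv _ (hw.know_know h)) (hc hψ v hv hwv)

theorem exists_acc_of_chain_notMem (hw : IsMCS w) {χ ψ : Formula ar X op ident}
    {l : List (Formula ar X op ident)} (hc : chain ψ l χ ∉ w) :
    ∃ v, IsMCS v ∧ Acc w v ∧ χ ∉ v := by
  induction l generalizing ψ w with
  | nil =>
    rw [chain, hw.imp_mem] at hc
    exact ⟨w, hw, hw.acc_refl, fun h => hc fun _ => h⟩
  | cons ψ' l ih =>
    rw [chain, hw.imp_mem, hw.know_mem] at hc
    push Not at hc
    obtain ⟨-, v, hv, hwv, hc⟩ := hc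
    obtain ⟨t, ht, hvt, h⟩ := ih hv hc
    exact ⟨t, ht, hw.acc_trans hwv hvt, h⟩

end IsMCS

theorem provable_of_forall_mem [Countable P] [Countable X] {φ : Formula ar X op ident}
    (h : ∀ w, IsMCS w → φ ∈ w) : Provable φ := by
  by_contra hn
  obtain ⟨w, hw, -, hφ⟩ := isTheory_provable.exists_isMCS (θ := neg φ) fun h' => hn
    (isTheory_provable.of_taut (fun v hn hc => by simp only [imp, hn, hc]; tauto) h')
  exact hw.neg_mem.1 hφ (h w hw)

theorem provable_imp_of_forall [Countable P] [Countable X] {φ ψ : Formula ar X op ident}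
    (h : ∀ w, IsMCS w → φ ∈ w → ψ ∈ w) : Provable (imp φ ψ) :=
  provable_of_forall_mem fun w hw => hw.imp_mem.2 (h w hw)

theorem Provable.chain_mono [Countable P] [Countable X] {χ χ' ψ : Formula ar X op ident}
    {l : List (Formula ar X op ident)} (h : Provable (imp χ χ')) (hc : Provable (chain ψ l χ)) :
    Provable (chain ψ l χ') :=
  provable_of_forall_mem fun _ hw => hw.chain_mono (hw.thm (.nec _ h)) (hw.thm hc)

theorem provable_chain {χ : Formula ar X op ident}
    (h : Provable χ) (ψ : Formula ar X op ident) (l : List (Formula ar X op ident)) :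
    Provable (chain ψ l χ) := by
  induction l generalizing ψ with
  | nil =>
    exact isTheory_provable.of_taut (fun v hn hc => by simp only [chain, imp, hn, hc]; tauto) h
  | cons ψ' l ih =>
    exact isTheory_provable.of_taut (fun v hn hc => by simp only [chain, imp, hn, hc]; tauto)
      (Provable.nec _ (ih ψ'))

/-- A finite condition `θ` is absorbed into the head of a chain; thus the Henkin property relative
to `T` also applies relative to `T` together with `θ`. -/
theorem IsTheory.chain_conj {T : Set (Formula ar X op ident)} (hT : IsTheory T)
    {θ ψ χ : Formula ar X op ident} {l : List (Formula ar X op ident)} :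
    chain (conj θ ψ) l χ ∈ T ↔ imp θ (chain ψ l χ) ∈ T := by
  cases l <;> constructor <;>
    exact fun h => hT.of_taut (fun v hn hc => by simp only [chain, imp, hn, hc]; tauto) h

end KnowWh

namespace KnowWh

open Formula

/-! ### The bundled operators, treated uniformly -/

variable {P : Type u} {ar : P → ℕ} {X : Type v} {op : WhOp} {ident : Bool}

/-- The formula whose existential closure is the mention-some part of the bundled operator. -/
def Formula.some : {op : WhOp} → Formula ar X op ident → Formula ar X op ident
  | WhOp.tB, φ => conj (bel φ) φ
  | WhOp.tBFS, φ => conj (bel φ) φ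
  | WhOp.K, φ => know φ
  | WhOp.KFS, φ => know φ

/-- The operators with the false-sensitivity clause. -/
def WhOp.IsFS (op : WhOp) : Prop := op = WhOp.tBFS ∨ op = WhOp.KFS

variable [DecidableEq X]

theorem IsMCS.bel_of_some [Countable P] [Countable X] {w : Set (Formula ar X op ident)}
    (hw : IsMCS w) {φ : Formula ar X op ident} (h : φ.some ∈ w) : bel φ ∈ w := by
  cases op
  · exact (hw.conj_mem.1 h).1
  · exact (hw.conj_mem.1 h).1
  · exact hw.bel_of_know h
  · exact hw.bel_of_know h

/-- A successor that knows `φ` also knows that it knows and believes `φ`. -/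
theorem IsMCS.bel_some [Countable P] [Countable X] {w : Set (Formula ar X op ident)}
    (hw : IsMCS w) {φ : Formula ar X op ident} (h : bel φ ∈ w) : bel φ.some ∈ w := by
  have hB : bel (conj (bel φ) φ) ∈ w := by
    obtain ⟨v, hv, hwv, hφ⟩ := hw.bel_mem.1 h
    refine hw.bel_mem.2 ⟨v, hv, hwv, hv.know_mem.2 fun t ht hvt => ht.conj_mem.2 ⟨?_, hvt _ hφ⟩⟩
    exact ht.bel_of_know (hvt _ (hv.know_know hφ))
  cases op
  · exact hB
  · exact hB
  · exact hw.bel_know h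
  · exact hw.bel_know h

theorem provable_some_mono [Countable P] [Countable X] {φ ψ : Formula ar X op ident}
    (h : Provable (imp φ ψ)) : Provable (imp φ.some ψ.some) := by
  refine provable_imp_of_forall fun w hw hφ => ?_
  cases op
  · have hφ := hw.conj_mem.1 hφ
    exact hw.conj_mem.2 ⟨hw.bel_mono h hφ.1, hw.mem_of_provable h hφ.2⟩
  · have hφ := hw.conj_mem.1 hφ
    exact hw.conj_mem.2 ⟨hw.bel_mono h hφ.1, hw.mem_of_provable h hφ.2⟩
  · exact hw.isTheory_know.mp (hw.isTheory_know.thm h) hφ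
  · exact hw.isTheory_know.mp (hw.isTheory_know.thm h) hφ

theorem provable_chain_neg_wh {x : X} {φ ψ : Formula ar X op ident}
    {l : List (Formula ar X op ident)} (hx : ∀ χ ∈ ψ :: l, x ∉ FV χ)
    (h : Provable (chain ψ l (neg φ.some))) : Provable (chain ψ l (neg (wh x φ))) := by
  cases op
  · exact .KwhtoTB x φ ψ l (Or.inl rfl) hx h
  · exact .KwhtoTB x φ ψ l (Or.inr rfl) hx h
  · exact .KwhtoK x φ ψ l (Or.inl rfl) hx h
  · exact .KwhtoK x φ ψ l (Or.inr rfl) hx h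

theorem provable_some_imp_wh (hop : ¬ op.IsFS) {x y : X} {φ : Formula ar X op ident}
    (hφ : Admissible x y φ) : Provable (imp (φ.subst x y).some (wh x φ)) := by
  cases op
  · exact .TBtoKwh x y φ rfl hφ
  · exact absurd (Or.inl rfl) hop
  · exact .KtoKwh x y φ rfl hφ
  · exact absurd (Or.inr rfl) hop

theorem provable_wh_imp_fs (hop : op.IsFS) {x y : X} {φ : Formula ar X op ident}
    (hφ : Admissible x y φ) :
    Provable (imp (wh x φ) (imp (bel (φ.subst x y)) (φ.subst x y))) :=
  .KwhtoFS x y φ hop hφ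

theorem admissible_subst_of_fresh {x z : X} :
    ∀ {φ : Formula ar X op ident}, z ∉ φ.FV → z ∉ φ.BV → Admissible z x (φ.subst x z)
  | atom _ _, _, _ => trivial
  | eq _ _ _, _, _ => trivial
  | neg φ, h, h' => admissible_subst_of_fresh (φ := φ) h h'
  | conj φ ψ, h, h' =>
    ⟨admissible_subst_of_fresh (φ := φ) (fun e => h (Or.inl e)) fun e => h' (Or.inl e),
      admissible_subst_of_fresh (φ := ψ) (fun e => h (Or.inr e)) fun e => h' (Or.inr e)⟩
  | know φ, h, h' => admissible_subst_of_fresh (φ := φ) h h'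
  | wh u φ, h, h' => by
    simp only [BV, Set.mem_insert_iff, not_or] at h'
    simp only [subst]
    split_ifs with e
    · exact Or.inl h
    · exact Or.inr ⟨e, admissible_subst_of_fresh (fun e' => h ⟨e', h'.1⟩) h'.2⟩

/-- The formulas for which witnesses are required. -/
def witnessTarget : X × Formula ar X op ident × Option X → Formula ar X op ident
  | (x, φ, none) => neg (wh x φ)
  | (x, φ, Option.some y) => imp (φ.subst x y).some (wh x φ)

/-- The formulas that express that `y` is a witness for the failure of `witnessTarget`. -/
def witnessInstance : X × Formula ar X op ident × Option X → X → Formula ar X op ident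
  | (x, φ, none), y => neg (φ.subst x y).some
  | (x, φ, Option.some _), y => imp (bel (φ.subst x y)) (φ.subst x y)

/-- A set of formulas has the Henkin property with respect to a set `B` of variables (those that are
used as bound variables) if every chain ending in a `witnessTarget` that is not in the set has a
witness outside `B`. -/
def IsHenkin (B : Set X) (T : Set (Formula ar X op ident)) : Prop :=
  ∀ q : X × Formula ar X op ident × Option X, q.2.1.BV ⊆ B → (∀ y ∈ q.2.2, y ∉ B) →
    ∀ ψ l, chain ψ l (witnessTarget q) ∉ T → ∃ y ∉ B, chain ψ l (witnessInstance q y) ∉ T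

theorem isHenkin_know {B : Set X} {w : Set (Formula ar X op ident)} (hw : IsMCS w)
    (h : IsHenkin B w) : IsHenkin B {φ | know φ ∈ w} := by
  intro q h₁ h₂ ψ l hn
  -- A tautologous head turns the boxed chain into a chain longer by one, to which the property of
  -- `w` applies.
  have hψ : imp ψ ψ ∈ w := hw.imp_mem.2 id
  obtain ⟨y, hy, h'⟩ := h q h₁ h₂ (imp ψ ψ) (ψ :: l) fun h' => hn (hw.imp_mem.1 h' hψ)
  exact ⟨y, hy, fun hk => h' (hw.imp_mem.2 fun _ => hk)⟩

variable [Countable P] [Countable X]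

theorem provable_chain_some_imp_wh {x y : X} {φ ψ : Formula ar X op ident}
    {l : List (Formula ar X op ident)} (hφ : Admissible x y φ) (hx : ∀ χ ∈ ψ :: l, x ∉ FV χ)
    (h : op.IsFS → Provable (chain ψ l (imp (bel φ) φ))) :
    Provable (chain ψ l (imp (φ.subst x y).some (wh x φ))) := by
  by_cases hop : op.IsFS
  · obtain rfl | rfl := hop
    · refine Provable.chain_mono ?_ (Provable.FSBtoKwh x y φ ψ l rfl hφ hx (h (Or.inl rfl)))
      exact .taut _ fun v hn hc => by simp only [Formula.some, imp, hn, hc]; tauto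
    · exact .FSKtoKwh x y φ ψ l rfl hφ hx (h (Or.inr rfl))
  · exact provable_chain (provable_some_imp_wh hop hφ) _ _

/-- BtoBKwh is an axiom for the false-sensitive operators and derivable for the others, since belief
in `φ` gives belief in its `some`-formula. -/
theorem provable_bel_imp_bel_wh {x y : X} {φ : Formula ar X op ident} (hφ : Admissible x y φ) :
    Provable (imp (bel (φ.subst x y)) (bel (wh x φ))) := by
  by_cases hop : op.IsFS
  · exact .BtoBKwh x y φ hop hφ
  · exact provable_imp_of_forall fun w hw h =>
      hw.bel_mono (provable_some_imp_wh hop hφ) (hw.bel_some h)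

/-- Congruence and renaming of bound variables for the bundled operators. -/
theorem provable_wh_imp_wh {x y : X} {φ ψ : Formula ar X op ident}
    (hy : y ∉ (wh x φ).FV) (hx : x ∉ (wh y ψ).FV)
    (hφ : Admissible x y φ) (hψ : Admissible y x ψ) (h₁ : Provable (imp (φ.subst x y) ψ))
    (h₂ : Provable (imp ψ (φ.subst x y))) (h₃ : Provable (imp φ (ψ.subst y x))) :
    Provable (imp (wh x φ) (wh y ψ)) := by
  -- The premise `wh x φ` supplies false-sensitivity for `ψ`, so any single witness suffices for `wh
  -- y ψ`.
  have key : Provable (chain (wh x φ) [] (imp (ψ.subst y x).some (wh y ψ))) := by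
    refine provable_chain_some_imp_wh hψ (by simpa using hy) fun hop => ?_
    refine provable_imp_of_forall fun w hw h => hw.imp_mem.2 fun hb => ?_
    exact hw.mem_of_provable h₁
      (hw.imp_mem.1 (hw.mem_of_provable (provable_wh_imp_fs hop hφ) h) (hw.bel_mono h₂ hb))
  -- If `wh y ψ` fails, `x` cannot be a witness for `φ`. As `x` is not free in the premise, this
  -- generalises to `neg (wh x φ)`, contradicting the premise itself.
  have h₄ : Provable (chain (conj (wh x φ) (neg (wh y ψ))) [] (neg φ.some)) :=
    isTheory_provable.of_taut₂ (fun v hn hc => by simp only [chain, imp, hn, hc]; tauto) key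
      (provable_some_mono h₃)
  have h₅ := provable_chain_neg_wh (x := x) (by
    simp only [List.mem_singleton, forall_eq, FV, Set.mem_union, not_or]
    exact ⟨fun h => h.2 rfl, hx⟩) h₄
  exact isTheory_provable.of_taut (fun v hn hc => by simp only [chain, imp, hn, hc]; tauto) h₅

theorem provable_wh_congr {x : X} {φ ψ : Formula ar X op ident} (h₁ : Provable (imp φ ψ))
    (h₂ : Provable (imp ψ φ)) : Provable (imp (wh x φ) (wh x ψ)) :=
  provable_wh_imp_wh (fun h => h.2 rfl) (fun h => h.2 rfl) (admissible_self x φ)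
    (admissible_self x ψ) (by rwa [subst_self]) (by rwa [subst_self]) (by rwa [subst_self])

theorem provable_wh_rename {x z : X} {φ : Formula ar X op ident} (hF : z ∉ φ.FV)
    (hB : z ∉ φ.BV) : Provable (imp (wh x φ) (wh z (φ.subst x z))) ∧
      Provable (imp (wh z (φ.subst x z)) (wh x φ)) := by
  have hself : ∀ χ : Formula ar X op ident, Provable (imp χ χ) := fun χ =>
    .taut _ fun v hn hc => by simp only [imp, hn, hc]; tauto
  have hz : z ∉ (wh x φ).FV := fun h => hF h.1
  have hx : x ∉ (wh z (φ.subst x z)).FV := by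
    rintro ⟨h, h'⟩
    rcases FV_subst_subset x z φ h with e | e
    · exact h' e
    · exact e.2 rfl
  have e : (φ.subst x z).subst z x = φ := by rw [subst_subst_of_fresh hF hB, subst_self]
  have hA : Admissible x z φ := admissible_of_notMem_BV hB
  have hA' := admissible_subst_of_fresh (x := x) hF hB
  exact ⟨provable_wh_imp_wh hz hx hA hA' (hself _) (hself _) (by rw [e]; exact hself _),
    provable_wh_imp_wh hx hz hA' hA (by rw [e]; exact hself _) (by rw [e]; exact hself _)
      (hself _)⟩

/-- Every formula is provably equivalent to one whose bound variables avoid a given finite set. -/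
theorem exists_equiv_disjoint_BV [Infinite X] {A : Set X} (hA : A.Finite)
    (φ : Formula ar X op ident) : ∃ ψ : Formula ar X op ident, ψ.FV ⊆ φ.FV ∧ Disjoint ψ.BV A ∧
      Provable (imp φ ψ) ∧ Provable (imp ψ φ) := by
  have hself : ∀ χ : Formula ar X op ident, Provable (imp χ χ) := fun χ =>
    .taut _ fun v hn hc => by simp only [imp, hn, hc]; tauto
  induction φ with
  | atom p t => exact ⟨atom p t, subset_rfl, Set.empty_disjoint A, hself _, hself _⟩
  | eq h a b => exact ⟨eq h a b, subset_rfl, Set.empty_disjoint A, hself _, hself _⟩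
  | neg φ ih =>
    obtain ⟨ψ, hF, hB, h₁, h₂⟩ := ih
    refine ⟨neg ψ, hF, hB, ?_, ?_⟩
    · exact isTheory_provable.of_taut (fun v hn hc => by simp only [imp, hn, hc]; tauto) h₂
    · exact isTheory_provable.of_taut (fun v hn hc => by simp only [imp, hn, hc]; tauto) h₁
  | conj φ φ' ih ih' =>
    obtain ⟨ψ, hF, hB, h₁, h₂⟩ := ih
    obtain ⟨ψ', hF', hB', h₁', h₂'⟩ := ih'
    refine ⟨conj ψ ψ', Set.union_subset_union hF hF', Set.disjoint_union_left.2 ⟨hB, hB'⟩,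
      ?_, ?_⟩
    · exact isTheory_provable.of_taut₂ (fun v hn hc => by simp only [imp, hn, hc]; tauto) h₁ h₁'
    · exact isTheory_provable.of_taut₂ (fun v hn hc => by simp only [imp, hn, hc]; tauto) h₂ h₂'
  | know φ ih =>
    obtain ⟨ψ, hF, hB, h₁, h₂⟩ := ih
    exact ⟨know ψ, hF, hB, .mp _ _ (.axK _ _) (.nec _ h₁), .mp _ _ (.axK _ _) (.nec _ h₂)⟩
  | wh x φ ih =>
    obtain ⟨ψ, hF, hB, h₁, h₂⟩ := ih
    obtain ⟨z, hz⟩ := ((hA.union (finite_FV ψ)).union (finite_BV ψ)).exists_notMem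
    simp only [Set.mem_union, not_or] at hz
    obtain ⟨⟨hzA, hzF⟩, hzB⟩ := hz
    obtain ⟨h₃, h₄⟩ := provable_wh_rename (x := x) hzF hzB
    refine ⟨wh z (ψ.subst x z), ?_, ?_, (provable_wh_congr h₁ h₂).imp_trans h₃,
      h₄.imp_trans (provable_wh_congr h₂ h₁)⟩
    · rintro y ⟨hy, hyz⟩
      rcases FV_subst_subset x z ψ hy with e | e
      · exact absurd e hyz
      · exact ⟨hF e.1, e.2⟩
    · rw [BV, BV_subst]
      exact Set.disjoint_insert_left.2 ⟨hzA, hB⟩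

/-! ### Henkin sets -/

/-- The rules read contrapositively: a fresh `z` is a generic instance, so if the chain were
provable for `z`, the rule would prove it for the operator binding `z`, and renaming `z` back to `x`
gives the target. -/
theorem isHenkin_provable [Infinite X] {B : Set X} (hB : B.Finite) :
    IsHenkin B {φ : Formula ar X op ident | Provable φ} := by
  rintro ⟨x, φ, o⟩ hφ ho ψ l hn
  have hfin : (⋃ χ ∈ {χ | χ ∈ ψ :: l}, FV χ).Finite :=
    (List.finite_toSet _).biUnion fun χ _ => finite_FV χ
  obtain ⟨z, hz⟩ := (((hB.union (finite_FV φ)).union (finite_BV φ)).union hfin).exists_notMem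
  simp only [Set.mem_union, not_or, Set.mem_iUnion, not_exists] at hz
  obtain ⟨⟨⟨hzB, hzF⟩, hzV⟩, hzl⟩ := hz
  obtain ⟨h₁, h₂⟩ := provable_wh_rename (x := x) hzF hzV
  refine ⟨z, hzB, fun h => hn ?_⟩
  cases o with
  | none =>
    refine Provable.chain_mono ?_ (provable_chain_neg_wh (fun χ hχ => hzl χ hχ) h)
    exact isTheory_provable.of_taut (fun v hn hc => by
      simp only [witnessTarget, imp, hn, hc]; tauto) h₁
  | some y =>
    have hy : y ∉ B := ho y rfl
    have hA : Admissible z y (φ.subst x z) :=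
      admissible_of_notMem_BV fun h => hy (hφ (BV_subst x z φ ▸ h))
    have := provable_chain_some_imp_wh hA (fun χ hχ => hzl χ hχ) fun _ => h
    rw [subst_subst_of_fresh hzF hzV] at this
    refine Provable.chain_mono ?_ this
    exact isTheory_provable.of_taut (fun v hn hc => by
      simp only [witnessTarget, imp, hn, hc]; tauto) h₂

theorem IsTheory.exists_isHenkin {B : Set X} {T : Set (Formula ar X op ident)} (hT : IsTheory T)
    (hH : IsHenkin B T) {θ : Formula ar X op ident} (h : neg θ ∉ T) :
    ∃ w, IsMCS w ∧ T ⊆ w ∧ θ ∈ w ∧ IsHenkin B w := by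
  obtain ⟨w, hw, hTw, hθ, hD⟩ := hT.exists_isMCS_generic
    (ι := (X × Formula ar X op ident × Option X) × Formula ar X op ident ×
      List (Formula ar X op ident))
    (D := fun i => {θ | i.1.2.1.BV ⊆ B → (∀ y ∈ i.1.2.2, y ∉ B) →
      Provable (imp θ (chain i.2.1 i.2.2 (witnessTarget i.1))) ∨
      ∃ y ∉ B, Provable (imp θ (neg (chain i.2.1 i.2.2 (witnessInstance i.1 y))))}) (by
    rintro ⟨q, ψ, l⟩ θ hθ
    by_cases hq : q.2.1.BV ⊆ B ∧ ∀ y ∈ q.2.2, y ∉ B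
    · by_cases hc : imp θ (chain ψ l (witnessTarget q)) ∈ T
      · refine ⟨conj θ (chain ψ l (witnessTarget q)), fun h => hθ ?_, ?_, fun _ _ => Or.inl ?_⟩
        · exact hT.of_taut₂ (fun v hn hc => by simp only [imp, hn, hc]; tauto) hc h
        · exact .taut _ fun v hn hc => by simp only [imp, hn, hc]; tauto
        · exact .taut _ fun v hn hc => by simp only [imp, hn, hc]; tauto
      -- Here `θ` does not force the chain, so `θ` joins its head and the Henkin property of `T`
      -- yields a witness whose failure is consistent with `θ`.
      · rw [← hT.chain_conj] at hc
        obtain ⟨y, hy, hc⟩ := hH q hq.1 hq.2 _ _ hc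
        rw [hT.chain_conj] at hc
        exact ⟨conj θ (neg (chain ψ l (witnessInstance q y))), hc,
          .taut _ fun v hn hc => by simp only [imp, hn, hc]; tauto,
          fun _ _ => Or.inr ⟨y, hy, .taut _ fun v hn hc => by simp only [imp, hn, hc]; tauto⟩⟩
    · exact ⟨θ, hθ, .taut _ fun v hn hc => by simp only [imp, hn, hc]; tauto,
        fun h₁ h₂ => absurd ⟨h₁, h₂⟩ hq⟩) h
  refine ⟨w, hw, hTw, hθ, fun q h₁ h₂ ψ l hn => ?_⟩
  obtain ⟨θ, hθ, hD⟩ := hD (q, ψ, l)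
  rcases hD h₁ h₂ with hD | ⟨y, hy, hD⟩
  · exact absurd (hw.mem_of_provable hD hθ) hn
  · exact ⟨y, hy, hw.neg_mem.1 (hw.mem_of_provable hD hθ)⟩

/-- Every Henkin maximal consistent set has a successor accessible from all its successors. -/
theorem IsHenkin.exists_final {B : Set X} {w : Set (Formula ar X op ident)} (hw : IsMCS w)
    (hH : IsHenkin B w) (φ : Formula ar X op ident) :
    ∃ u, IsMCS u ∧ IsHenkin B u ∧ ∀ v, IsMCS v → Acc w v → Acc v u := by
  -- Beliefs are consistent. The given `φ` only supplies a tautology, as the language need not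
  -- contain any formula.
  obtain ⟨u, hu, hBu, -⟩ := hw.isTheory_bel.exists_isMCS (θ := imp φ φ) (by
    intro h
    obtain ⟨v, hv, -, h⟩ := hw.bel_mem.1 h
    exact hv.neg_mem.1 (hv.acc_refl _ h) (hv.imp_mem.2 id))
  have hfin : ∀ v, IsMCS v → Acc w v → Acc v u := fun v hv hwv χ hχ =>
    hBu (hw.bel_mem.2 ⟨v, hv, hwv, hχ⟩)
  have hwu : Acc w u := hfin w hw hw.acc_refl
  have hknow : ∀ χ, bel χ ∈ w → Formula.know χ ∈ u := fun χ h => hBu (hw.bel_know h)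
  refine ⟨u, hu, ?_, hfin⟩
  rintro ⟨x, φ, o⟩ hφ ho ψ l hn
  cases o with
  | none =>
    have hψ : imp ψ ψ ∈ w := hw.imp_mem.2 id
    -- A boxed chain in `w` would be believed there and so lie in `u`. Hence `w` provides `y` whose
    -- `some`-formula holds at a successor; it is then believed at `w` and known at `u`, and `y`
    -- refutes every instance beyond `u`.
    obtain ⟨y, hy, h⟩ := hH (x, φ, none) hφ ho (imp ψ ψ) (ψ :: l) fun h =>
      hn (hBu (hw.bel_of_know (hw.imp_mem.1 h hψ)))
    obtain ⟨v, hv, hwv, h⟩ := hw.exists_acc_of_chain_notMem h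
    have h : (φ.subst x y).some ∈ v := not_not.1 fun h' => h (hv.neg_mem.2 h')
    have hk := hknow _ (hw.bel_some (hw.bel_of_acc' hv hwv (hv.bel_of_some h)))
    refine ⟨y, hy, fun hc => hn (hu.chain_mono (hu.isTheory_know.of_taut ?_ hk) hc)⟩
    exact fun v hn hc => by simp only [witnessInstance, witnessTarget, imp, hn, hc]; tauto
  | some y =>
    have hy : y ∉ B := ho y rfl
    obtain ⟨v, hv, huv, h⟩ := hu.exists_acc_of_chain_notMem hn
    rw [witnessTarget, hv.imp_mem, Classical.not_imp] at h
    -- This case never arises: the belief at `v` is already a belief at `w`, so by BtoBKwh `wh x φ`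
    -- is believed at `w` and known at `u`.
    have hb := hw.bel_of_acc' hu hwu (hu.bel_of_acc' hv huv (hv.bel_of_some h.1))
    have hA : Admissible x y φ := admissible_of_notMem_BV fun h => hy (hφ h)
    exact absurd (huv _ (hknow _ (hw.mem_of_provable (provable_bel_imp_bel_wh hA) hb))) h.2

end KnowWh

namespace KnowWh

open Formula

/-! ### The canonical model -/

variable {P : Type u} {ar : P → ℕ} {X : Type v} [DecidableEq X] {op : WhOp} {ident : Bool}

namespace IsMCS

variable {w : Set (Formula ar X op ident)}

theorem eq_subst (hw : IsMCS w) {h : ident = true} {x y : X} (hxy : eq h x y ∈ w) (z : X)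
    {φ : Formula ar X op ident} (hx : Admissible z x φ) (hy : Admissible z y φ)
    (hφ : φ.subst z x ∈ w) : φ.subst z y ∈ w :=
  hw.imp_mem.1 (hw.mem_of_provable (.eqSubst h x y z φ hx hy) hxy) hφ

variable [Infinite X]

theorem eq_symm (hw : IsMCS w) {h : ident = true} {x y : X} (hxy : eq h x y ∈ w) :
    eq h y x ∈ w := by
  obtain ⟨z, hz⟩ := (Set.finite_singleton x).exists_notMem
  have hz : x ≠ z := fun e => hz e.symm
  have := hw.eq_subst hxy z (φ := eq h z x) trivial trivial
  simp only [subst, if_true, if_neg hz] at this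
  exact this (hw.thm (.eqRefl h x))

theorem eq_trans (hw : IsMCS w) {h : ident = true} {x y c : X} (hxy : eq h x y ∈ w)
    (hyc : eq h y c ∈ w) : eq h x c ∈ w := by
  obtain ⟨z, hz⟩ := (Set.finite_singleton c).exists_notMem
  have hz : c ≠ z := fun e => hz e.symm
  have := hw.eq_subst (hw.eq_symm hxy) z (φ := eq h z c) trivial trivial
  simp only [subst, if_true, if_neg hz] at this
  exact this hyc

/-- Identity is rigid: distinctness persists by axiom, and equality persists by substituting into
the theorem `[K] x ≈ x`. So the quotient taken at the root is right at every world. -/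
theorem eq_mem_of_acc (hw : IsMCS w) {v : Set (Formula ar X op ident)} (hv : IsMCS v)
    (hwv : Acc w v) {h : ident = true} {x y : X} : eq h x y ∈ v ↔ eq h x y ∈ w := by
  constructor
  · intro hxy
    by_contra hn
    exact hv.neg_mem.1 (hwv _ (hw.mem_of_provable (.neKnow h x y) (hw.neg_mem.2 hn))) hxy
  · intro hxy
    obtain ⟨z, hz⟩ := (Set.finite_singleton x).exists_notMem
    have hz : x ≠ z := fun e => hz e.symm
    have := hw.eq_subst hxy z (φ := know (eq h x z)) trivial trivial
    simp only [subst, if_true, if_neg hz] at this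
    exact hwv _ (this (hw.thm (.nec _ (.eqRefl h x))))

theorem atom_congr (hw : IsMCS w) {p : P} {s t : Fin (ar p) → X}
    (h : ∀ i, s i = t i ∨ ∃ h : ident = true, eq h (s i) (t i) ∈ w) (hs : atom p s ∈ w) :
    atom p t ∈ w := by
  classical
  have key : ∀ J : Finset (Fin (ar p)), atom p (fun i => if i ∈ J then t i else s i) ∈ w := by
    intro J
    induction J using Finset.induction_on with
    | empty => simpa using hs
    | insert j J hj ih =>
      set r : Fin (ar p) → X := fun i => if i ∈ J then t i else s i with hr
      have e : (fun i => if i ∈ insert j J then t i else s i) = Function.update r j (t j) := by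
        funext i
        by_cases hi : i = j
        · simp [hi]
        · simp [hi, hr]
      have e' : r = Function.update r j (s j) := by
        rw [eq_comm, Function.update_eq_self_iff]
        simp [hr, hj]
      rw [e]
      rw [e'] at ih
      rcases h j with hj | ⟨h, hj⟩
      · rwa [← hj]
      · obtain ⟨z, hz⟩ := (Set.finite_range r).exists_notMem
        have hsub : ∀ a, (atom p (Function.update r j z) : Formula ar X op ident).subst z a =
            atom p (Function.update r j a) := by
          intro a
          simp only [subst]
          congr 1
          funext i
          by_cases hi : i = j
          · simp [hi]
          · simp only [Function.update_of_ne hi]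
            rw [if_neg fun e => hz ⟨i, e⟩]
        have := hw.eq_subst hj z (φ := atom p (Function.update r j z)) trivial trivial
        rw [hsub, hsub] at this
        exact this ih
  simpa using key Finset.univ

end IsMCS

/-- Identity of variables at a maximal consistent set. -/
def identSetoid [Infinite X] {w : Set (Formula ar X op ident)} (hw : IsMCS w) (B : Set X) :
    Setoid {x : X // x ∉ B} where
  r a b := a.1 = b.1 ∨ ∃ h : ident = true, eq h a.1 b.1 ∈ w
  iseqv :=
    { refl := fun _ => Or.inl rfl
      symm := by
        rintro a b (h | ⟨h, hab⟩)
        · exact Or.inl h.symm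
        · exact Or.inr ⟨h, hw.eq_symm hab⟩
      trans := by
        rintro a b c (h | ⟨h, hab⟩) (h' | ⟨h', hbc⟩)
        · exact Or.inl (h.trans h')
        · exact Or.inr ⟨h', h ▸ hbc⟩
        · exact Or.inr ⟨h, h' ▸ hab⟩
        · exact Or.inr ⟨h, hw.eq_trans hab hbc⟩ }

/-- In a Henkin maximal consistent set the bundled operators satisfy their truth conditions. -/
theorem IsHenkin.wh_mem [Countable P] [Countable X] {B : Set X}
    {w : Set (Formula ar X op ident)} (hw : IsMCS w) (hH : IsHenkin B w) {x : X}
    {φ : Formula ar X op ident} (hφ : φ.BV ⊆ B) :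
    wh x φ ∈ w ↔ (∃ a : {x // x ∉ B}, (φ.subst x a).some ∈ w) ∧
      (op.IsFS → ∀ b : {x // x ∉ B}, bel (φ.subst x b) ∈ w → φ.subst x b ∈ w) := by
  have hA : ∀ a : {x // x ∉ B}, Admissible x a.1 φ := fun a =>
    admissible_of_notMem_BV fun h => a.2 (hφ h)
  have htop : imp φ φ ∈ w := hw.imp_mem.2 id
  have hchain : ∀ {χ}, chain (imp φ φ) [] χ ∈ w ↔ χ ∈ w := fun {χ} =>
    hw.imp_mem.trans ⟨fun h => h htop, fun h _ => h⟩
  refine ⟨fun h => ⟨?_, fun hop b hb => ?_⟩, fun ⟨⟨a, ha⟩, hF⟩ => ?_⟩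
  · obtain ⟨a, haB, ha⟩ := hH (x, φ, none) hφ (by simp) (imp φ φ) [] fun h' =>
      hw.neg_mem.1 (hchain.1 h') h
    rw [hchain] at ha
    exact ⟨⟨a, haB⟩, not_not.1 fun h' => ha (hw.neg_mem.2 h')⟩
  · exact hw.imp_mem.1 (hw.mem_of_provable (provable_wh_imp_fs hop (hA b)) h) hb
  · by_cases hop : op.IsFS
    · by_contra hn
      obtain ⟨z, hzB, hz⟩ := hH (x, φ, Option.some a.1) hφ (by simpa using a.2) (imp φ φ) []
        fun h' => hn (hw.imp_mem.1 (hchain.1 h') ha)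
      rw [hchain] at hz
      exact hz (hw.imp_mem.2 (hF hop ⟨z, hzB⟩))
    · exact hw.mem_of_provable (provable_some_imp_wh hop (hA a)) ha

section Canonical

variable [Infinite X] {w₀ : Set (Formula ar X op ident)} (h₀ : IsMCS w₀) {B : Set X}
  (hB₀ : IsHenkin B w₀) (hB : B.Finite)

/-- The canonical model generated by a Henkin maximal consistent set. -/
def canonicalModel : KripkeModel.{u, max u v, v} ar where
  W := {w : Set (Formula ar X op ident) // IsMCS w ∧ IsHenkin B w ∧ Acc w₀ w}
  D := Quotient (identSetoid h₀ B)
  nonempty_W := ⟨⟨w₀, h₀, hB₀, h₀.acc_refl⟩⟩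
  nonempty_D := hB.exists_notMem.elim fun x hx => ⟨Quotient.mk _ ⟨x, hx⟩⟩
  R w v := Acc w.1 v.1
  ρ p w := {d | ∃ t : Fin (ar p) → {x : X // x ∉ B}, (∀ j, d j = Quotient.mk _ (t j)) ∧
    atom p (fun j => (t j).1) ∈ w.1}

variable [Countable P] [Countable X]

theorem canonicalModel_isS42 (φ : Formula ar X op ident) :
    (canonicalModel h₀ hB₀ hB).IsS42 where
  refl w := w.2.1.acc_refl
  trans w _ _ h₁ h₂ := w.2.1.acc_trans h₁ h₂
  conv w := by
    obtain ⟨u, hu, huB, hfin⟩ := IsHenkin.exists_final w.2.1 w.2.2.1 φ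
    refine ⟨⟨u, hu, huB, ?_⟩, fun v hv => hfin v.1 v.2.1 hv⟩
    exact h₀.acc_trans w.2.2.2 (hfin _ w.2.1 w.2.1.acc_refl)

variable {h₀ hB₀ hB}

/-- The existence lemma within Henkin sets: what `w` knows is a Henkin theory, so a refuting
successor can be chosen Henkin over the same variables. -/
theorem canonicalModel_knows {p : (canonicalModel h₀ hB₀ hB).W → Prop}
    {φ : Formula ar X op ident} (h : ∀ v, p v ↔ φ ∈ v.1) (w : (canonicalModel h₀ hB₀ hB).W) :
    (canonicalModel h₀ hB₀ hB).Knows p w ↔ know φ ∈ w.1 := by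
  refine ⟨fun hp => ?_, fun hk v hv => (h v).2 (hv _ hk)⟩
  by_contra hn
  have hT := w.2.1.isTheory_know
  obtain ⟨v, hv, hwv, hφ, hvB⟩ := hT.exists_isHenkin (isHenkin_know w.2.1 w.2.2.1) (θ := neg φ)
    fun h' => hn (hT.of_taut (fun v hn hc => by simp only [imp, hn, hc]; tauto) h')
  have hwv : Acc w.1 v := hwv
  exact hv.neg_mem.1 hφ ((h ⟨v, hv, hvB, h₀.acc_trans w.2.2.2 hwv⟩).1 (hp _ hwv))

theorem canonicalModel_believes {p : (canonicalModel h₀ hB₀ hB).W → Prop}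
    {φ : Formula ar X op ident} (h : ∀ v, p v ↔ φ ∈ v.1) (w : (canonicalModel h₀ hB₀ hB).W) :
    (canonicalModel h₀ hB₀ hB).Believes p w ↔ bel φ ∈ w.1 := by
  rw [bel, poss, w.2.1.neg_mem]
  refine not_congr (canonicalModel_knows (fun v => ?_) w)
  rw [v.2.1.neg_mem]
  exact not_congr (canonicalModel_knows h v)

theorem canonicalModel_knowsWh
    {p : (canonicalModel h₀ hB₀ hB).D → (canonicalModel h₀ hB₀ hB).W → Prop} {x : X}
    {φ : Formula ar X op ident} (hφ : φ.BV ⊆ B)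
    (h : ∀ (a : {x // x ∉ B}) v, p (Quotient.mk _ a) v ↔ φ.subst x a ∈ v.1)
    (w : (canonicalModel h₀ hB₀ hB).W) :
    (canonicalModel h₀ hB₀ hB).KnowsWh op p w ↔ wh x φ ∈ w.1 := by
  have hex : ∀ r : (canonicalModel h₀ hB₀ hB).D → Prop, (∃ a, r a) ↔ ∃ a : {x // x ∉ B},
      r (Quotient.mk _ a) := fun r => Quotient.mk_surjective.exists
  have hall : ∀ r : (canonicalModel h₀ hB₀ hB).D → Prop, (∀ a, r a) ↔ ∀ a : {x // x ∉ B},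
      r (Quotient.mk _ a) := fun r => Quotient.mk_surjective.forall
  have h₁ : (∃ a, (canonicalModel h₀ hB₀ hB).Believes (p a) w ∧ p a w) ↔
      ∃ a : {x // x ∉ B}, conj (bel (φ.subst x a)) (φ.subst x a) ∈ w.1 := by
    rw [hex]
    refine exists_congr fun a => ?_
    rw [w.2.1.conj_mem]
    exact and_congr (canonicalModel_believes (h a) w) (h a w)
  have h₂ : (∃ a, (canonicalModel h₀ hB₀ hB).Knows (p a) w) ↔
      ∃ a : {x // x ∉ B}, know (φ.subst x a) ∈ w.1 := by
    rw [hex]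
    exact exists_congr fun a => canonicalModel_knows (h a) w
  have h₃ : (∀ b, (canonicalModel h₀ hB₀ hB).Believes (p b) w → p b w) ↔
      ∀ b : {x // x ∉ B}, bel (φ.subst x b) ∈ w.1 → φ.subst x b ∈ w.1 := by
    rw [hall]
    exact forall_congr' fun b => imp_congr (canonicalModel_believes (h b) w) (h b w)
  rw [IsHenkin.wh_mem w.2.1 w.2.2.1 hφ]
  cases op with
  | tB => exact h₁.trans (iff_self_and.2 fun _ h => by simp [WhOp.IsFS] at h)
  | tBFS => exact and_congr h₁ (h₃.trans ⟨fun h _ => h, fun h => h (Or.inl rfl)⟩)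
  | K => exact h₂.trans (iff_self_and.2 fun _ h => by simp [WhOp.IsFS] at h)
  | KFS => exact and_congr h₂ (h₃.trans ⟨fun h _ => h, fun h => h (Or.inr rfl)⟩)

/-- Truth lemma. -/
theorem canonicalModel_sat {φ : Formula ar X op ident} (hφ : φ.BV ⊆ B)
    (w : (canonicalModel h₀ hB₀ hB).W) (σ : X → {x // x ∉ B}) :
    (canonicalModel h₀ hB₀ hB).Sat φ w (fun x => Quotient.mk _ (σ x)) ↔
      φ.msubst (fun x => (σ x).1) ∈ w.1 := by
  have hr : ∀ (w : (canonicalModel h₀ hB₀ hB).W) {a b : {x // x ∉ B}},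
      Quotient.mk (identSetoid h₀ B) a = Quotient.mk _ b ↔
        a.1 = b.1 ∨ ∃ h : ident = true, eq h a.1 b.1 ∈ w.1 := by
    intro w a b
    refine Quotient.eq.trans (or_congr Iff.rfl (exists_congr fun h => ?_))
    exact (h₀.eq_mem_of_acc w.2.1 w.2.2.2).symm
  induction φ generalizing w σ with
  | atom p t =>
    refine ⟨fun ⟨s, hs, h⟩ => ?_, fun h => ⟨fun j => σ (t j), fun _ => rfl, h⟩⟩
    exact w.2.1.atom_congr (fun i => (hr w).1 (hs i).symm) h
  | eq e a b =>
    refine (hr w).trans ⟨?_, fun h => Or.inr ⟨e, h⟩⟩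
    rintro (h | ⟨_, h⟩)
    · simp only [msubst, h]
      exact w.2.1.thm (.eqRefl e _)
    · exact h
  | neg φ ih => exact (not_congr (ih hφ w σ)).trans w.2.1.neg_mem.symm
  | conj φ ψ ih₁ ih₂ =>
    rw [BV, Set.union_subset_iff] at hφ
    exact (and_congr (ih₁ hφ.1 w σ) (ih₂ hφ.2 w σ)).trans w.2.1.conj_mem.symm
  | know φ ih =>
    exact canonicalModel_knows (fun v => ih hφ v σ) w
  | wh x φ ih =>
    rw [BV, Set.insert_subset_iff] at hφ
    refine canonicalModel_knowsWh (by rw [BV_msubst]; exact hφ.2) (fun a v => ?_) w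
    -- Objects lie outside `B` while `x` is bound, so no value of `σ` is captured.
    have hσ : ∀ u, u ≠ x → (σ u).1 ≠ x := fun u _ e => (σ u).2 (e ▸ hφ.1)
    rw [subst_msubst_update hσ]
    have e₁ := Function.comp_update (Quotient.mk (identSetoid h₀ B)) σ x a
    have e₂ := Function.comp_update (Subtype.val : {x // x ∉ B} → X) σ x a
    refine (iff_of_eq ?_).trans ((ih hφ.2 v (Function.update σ x a)).trans (iff_of_eq ?_))
    · exact congrArg ((canonicalModel h₀ hB₀ hB).Sat φ v) e₁.symm
    · exact congrArg (fun τ => φ.msubst τ ∈ v.1) e₂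

end Canonical

/-- Weak completeness for countable languages. -/
theorem exists_countermodel [Infinite X] [Countable P] [Countable X] (φ : Formula ar X op ident)
    (hφ : ¬ Provable φ) :
    ∃ M : KripkeModel.{u, max u v, v} ar, M.IsS42 ∧ ∃ w σ, ¬ M.Sat φ w σ := by
  obtain ⟨ψ, hF, hdisj, h₁, h₂⟩ := exists_equiv_disjoint_BV (finite_FV φ) φ
  have hB := finite_BV ψ
  obtain ⟨w, hw, -, hψ, hH⟩ := isTheory_provable.exists_isHenkin (isHenkin_provable hB)
    (θ := neg ψ) fun h => hφ (.mp _ _ h₂ (isTheory_provable.of_taut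
      (fun v hn hc => by simp only [imp, hn, hc]; tauto) h))
  obtain ⟨x₀, hx₀⟩ := hB.exists_notMem
  classical
  -- Each variable denotes itself; the default `x₀` is reached only at bound variables, none of
  -- which is free in `ψ`.
  let σ : X → {x // x ∉ ψ.BV} := fun x => if hx : x ∉ ψ.BV then ⟨x, hx⟩ else ⟨x₀, hx₀⟩
  have hσ : ψ.msubst (fun x => (σ x).1) = ψ := by
    refine (msubst_congr fun x hx => ?_).trans (msubst_id ψ)
    have : x ∉ ψ.BV := fun h => Set.disjoint_left.1 hdisj h (hF hx)
    simp [σ, this]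
  have hM := canonicalModel_isS42 hw hH hB φ
  refine ⟨canonicalModel hw hH hB, hM, ⟨w, hw, hH, hw.acc_refl⟩, fun x => Quotient.mk _ (σ x),
    fun hs => ?_⟩
  -- Soundness transfers the refutation of the renamed `ψ` back to `φ`.
  have hs' := (KripkeModel.sat_imp _ _ _ _ _).1 (hM.sat_of_provable h₁ _ _) hs
  have hmem := (canonicalModel_sat subset_rfl _ σ).1 hs'
  rw [hσ] at hmem
  exact hw.neg_mem.1 hψ hmem

end KnowWh

theorem mainTheorem1 {P : Type u} (ar : P → ℕ) (X : Type v) [DecidableEq X] [Infinite X]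
    (op : KnowWh.WhOp) (ident : Bool) :
    -- soundness
    (∀ (Γ : Set (KnowWh.Formula ar X op ident)) (φ : KnowWh.Formula ar X op ident),
      KnowWh.Derives Γ φ → KnowWh.Entails.{u, v, w₁, w₂} Γ φ) ∧
    -- strong completeness
    (∀ (Γ : Set (KnowWh.Formula ar X op ident)) (φ : KnowWh.Formula ar X op ident),
      KnowWh.Entails.{u, v, max u v, max u v} Γ φ → KnowWh.Derives Γ φ) := by
  refine ⟨fun _ _ => KnowWh.entails_of_derives, fun _ _ => KnowWh.derives_of_entails_of_weak ?_⟩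
  exact KnowWh.exists_countermodel_of_countable fun _ _ _ _ _ => KnowWh.exists_countermodel
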